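/- **Notation.** Let $m,n\ge 1$, $\mathbb N=\{0,1,2,\dots\}$. For $\xi=(u_1,\dots,u_m)\in\mathbb N^m$ put $\deg\xi=u_1+\dots+u_m$; $\mathbf k\in\mathbb N^m$ is the tuple with a one in position $k$ and zeros elsewhere; $\operatorname{LUB}$ is the componentwise maximum. On $\mathbb N^m\times\{1,\dots,n\}$ put $(\xi,i)\le(\tau,j)$ iff $i=j$ and $\xi\le\tau$ componentwise, $\deg(\xi,i)=\deg\xi$, and $\Gamma(p)=\{\alpha:\deg\alpha\le p\}$. An antichain sequence is a finite sequence $\bar\alpha=(\alpha_1,\dots,\alpha_k)$ in $\mathbb N^m\times\{1,\dots,n\}$ with $\alpha_i,\alpha_j$ incomparable for $i\ne j$; let $\Gamma_{\bar\alpha}(p)$ be the set of its entries lying in $\Gamma(p)$. For a set $G$ of indices let $\gamma(G)=\{(\operatorname{LUB}(\eta,\tau),i):\eta\neq\tau,\ (\eta,i),(\tau,i)\in G\}$. **The number $C_{r,m}^n$.** For $r\ge 0$, let $D_{r,\bar\alpha}$ be the smallest integer $p\ge r$ such that for every $(\tau,l)\in\gamma(\Gamma_{\bar\alpha}(p))\setminus\Gamma(p)$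 and all $1\le i<j\le m$ for which $(\tau-\mathbf i,l)\ge\beta_1$ and $(\tau-\mathbf j,l)\ge\beta_2$ for some $\beta_1,\beta_2\in\Gamma_{\bar\alpha}(p)$, there are $(\eta_1,l),\dots,(\eta_s,l)\in\Gamma_{\bar\alpha}(p)$ and indices $k_1=i,k_2,\dots,k_s=j$ with $\eta_\ell\le\tau-\mathbf k_\ell$ for all $\ell$ and $\deg\operatorname{LUB}(\eta_\ell,\eta_{\ell+1})\le p$ for $1\le\ell<s$. Here $\tau-\mathbf k$ is required to lie in $\mathbb N^m$. Then $$C_{r,m}^n=\max\{D_{r,\bar\alpha}:\bar\alpha\text{ an antichain sequence of }\mathbb N^m\times\{1,\dots,n\}\}\in\mathbb N\cup\{\infty\}.$$ **The number $T_{r,m}^n$.** Let $(K,\partial_1,\dots,\partial_m)$ be a differential field of characteristic zero with commuting derivations. A differential kernel of length $r$ over $K$ (in $n$ indeterminates) is a field extension $L=K(a_i^\xi:(\xi,i)\in\Gamma(r))$ together with derivations $D_k:K(a_i^\xi:\deg\xi\le r-1)\to L$ extending $\partial_k$ with $D_ka_i^\xi=a_i^{\xi+\mathbf k}$ whenever $\deg\xi\le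 r-1$ ($1\le k\le m$). A prolongation of length $s\ge r$ is a differential kernel $L'=K(a_i^\xi:(\xi,i)\in\Gamma(s))$ of length $s$ that is a field extension of $L$, has the same generators $a_i^\xi$ for $(\xi,i)\in\Gamma(r)$, and whose derivations extend those of $L$. A regular realization of $L$ is a tuple $g=(g_1,\dots,g_n)$ in a differential field extension $(M,\partial'_1,\dots,\partial'_m)$ of $K$ with commuting derivations such that $a_i^\xi\mapsto(\partial')^\xi g_i$, $(\xi,i)\in\Gamma(r)$, defines a $K$-isomorphism $L\to K((\partial')^\xi g_i:(\xi,i)\in\Gamma(r))$. Let $T_{r,m}^n$ be the smallest integer $t\ge r$ such that, for every such $K$, every differential kernel over $K$ of length $r$ (in $n$ indeterminates) which has a prolongation of length $t$ has a regular realization. **Corollary.** For every integer $r\ge 0$, $$C_{r,2}^1=2r\qquad\text{and}\qquad C_{r,3}^1=3(2^r-1).$$ In particular $T_{r,3}^1\le 3(2^r-1)$. -/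

import Mathlib

universe u

namespace DiffKer

/-! ### Indices -/

/-- The index set `ℕ^m × {1, …, n}`. (Its componentwise order as a product type is never used.) -/
abbrev Idx (m n : ℕ) : Type := (Fin m → ℕ) × Fin n

/-- The degree `u₁ + ⋯ + u_m` of `ξ = (u₁, …, u_m)`. -/
def deg {m : ℕ} (ξ : Fin m → ℕ) : ℕ := ∑ k, ξ k

/-- `unit k` is the tuple with a one in position `k` and zeros elsewhere. -/
def unit {m : ℕ} (k : Fin m) : Fin m → ℕ := Pi.single k 1

/-- `Γ(r)`, the set of indices of degree at most `r`. -/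
def Gam (m n r : ℕ) : Set (Idx m n) := {α | deg α.1 ≤ r}

/-- `Γ(r - 1)`, the set of indices of degree less than `r`; it is empty for `r = 0`. -/
def GamPred (m n r : ℕ) : Set (Idx m n) := {α | deg α.1 < r}

/-- The order on indices: `(ξ, i) ≤ (τ, j)` iff `i = j` and `ξ ≤ τ` in the product order. -/
def IdxLE {m n : ℕ} (α β : Idx m n) : Prop := α.2 = β.2 ∧ α.1 ≤ β.1

/-! ### The combinatorial number `C` -/

/-- `(α₁, …, α_k)` is an antichain sequence: entries at different positions are incomparable. -/
def IsAntichainSeq {m n k : ℕ} (α : Fin k → Idx m n) : Prop :=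
  ∀ i j, i ≠ j → ¬ IdxLE (α i) (α j) ∧ ¬ IdxLE (α j) (α i)

/-- `Γ_α(p)`, the set of entries of the sequence `α` that have degree at most `p`. -/
def GamSeq {m n k : ℕ} (α : Fin k → Idx m n) (p : ℕ) : Set (Idx m n) :=
  Set.range α ∩ Gam m n p

/-- `γ(G)`, the set of all `(LUB(η, τ), i)` with `η ≠ τ` and `(η, i), (τ, i) ∈ G`. The least upper
bound in the product order on `ℕ^m` is the componentwise maximum `η ⊔ τ`. -/
def lubs {m n : ℕ} (G : Set (Idx m n)) : Set (Idx m n) :=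
  {σ | ∃ η τ : Fin m → ℕ, ∃ i : Fin n, η ≠ τ ∧ (η, i) ∈ G ∧ (τ, i) ∈ G ∧ σ = (η ⊔ τ, i)}

/-- The chain condition at level `p` on a set `G` of indices: for all `(τ, l) ∈ γ(G) \ Γ(p)` and
`i < j` such that `(τ - 𝐢, l)` and `(τ - 𝐣, l)` lie above elements of `G`, there are
`(η_0, l), …, (η_s, l) ∈ G` and `κ_0 = i, …, κ_s = j` with `η_q ≤ τ - 𝛋_q`, and with
`deg LUB(η_q, η_{q+1}) ≤ p` for `q < s`.
An inequality `η ≤ τ - 𝐤` in `ℕ^m` (where `τ - 𝐤` has to lie in `ℕ^m`) is written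
as `η + 𝐤 ≤ τ`. -/
def ChainCondition {m n : ℕ} (p : ℕ) (G : Set (Idx m n)) : Prop :=
  ∀ (τ : Fin m → ℕ) (l : Fin n), (τ, l) ∈ lubs G → (τ, l) ∉ Gam m n p →
    ∀ i j : Fin m, i < j →
      (∃ β, (β, l) ∈ G ∧ β + unit i ≤ τ) → (∃ β, (β, l) ∈ G ∧ β + unit j ≤ τ) →
        ∃ (s : ℕ) (η : Fin (s + 1) → Fin m → ℕ) (κ : Fin (s + 1) → Fin m),
          (∀ q, (η q, l) ∈ G ∧ η q + unit (κ q) ≤ τ) ∧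
          κ 0 = i ∧ κ (Fin.last s) = j ∧
          ∀ q : Fin s, deg (η q.castSucc ⊔ η q.succ) ≤ p

/-- `D_{r,α}`, the smallest integer `p ≥ r` such that the chain condition at level `p` holds for
`Γ_α(p)` (as an extended natural number, so that no convention is needed for an empty set). -/
noncomputable def D {m n k : ℕ} (r : ℕ) (α : Fin k → Idx m n) : ℕ∞ :=
  ⨅ (p : ℕ) (_ : r ≤ p ∧ ChainCondition p (GamSeq α p)), (p : ℕ∞)

/-- `C_{r,m}^n`, the maximum of `D_{r,α}` over all antichain sequences `α` of `ℕ^m × {1, …, n}`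
(`∞` if there is no maximum; a finite supremum of extended natural numbers is attained). -/
noncomputable def C (r m n : ℕ) : ℕ∞ :=
  ⨆ (k : ℕ) (α : Fin k → Idx m n) (_ : IsAntichainSeq α), D r α

/-! ### Differential kernels and the number `T` -/

/-- Pairwise commuting derivations. -/
def Commuting {m : ℕ} {K : Type u} [Field K] (δ : Fin m → Derivation ℤ K K) : Prop :=
  ∀ i j x, δ i (δ j x) = δ j (δ i x)

/-- `∂^ξ x = ∂₁^{u₁} ⋯ ∂_m^{u_m} x` for `ξ = (u₁, …, u_m)`. -/
def iterDeriv {m : ℕ} {M : Type u} [Field M] (δ : Fin m → Derivation ℤ M M)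
    (ξ : Fin m → ℕ) (x : M) : M :=
  (List.finRange m).foldr (fun k y => (δ k)^[ξ k] y) x

/-- A differential kernel `L = K(a^ξ_i : (ξ, i) ∈ Γ(r))` of length `r` in `n` indeterminates over
the differential field `(K, δ)`. The generator `a^ξ_i` is `a (ξ, i)`; the values of `a` outside
`Γ(r)` play no role. -/
structure DifferentialKernel {m : ℕ} {K : Type u} [Field K] (δ : Fin m → Derivation ℤ K K)
    (n r : ℕ) (L : Type u) [Field L] [Algebra K L] where
  a : Idx m n → L
  adjoin_eq_top : IntermediateField.adjoin K (a '' Gam m n r) = ⊤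
  /-- The derivations `D_k : K(a^ξ_i : (ξ, i) ∈ Γ(r - 1)) → L`. -/
  D : Fin m → Derivation ℤ (IntermediateField.adjoin K (a '' GamPred m n r)) L
  D_extends : ∀ k x, D k (algebraMap K (IntermediateField.adjoin K (a '' GamPred m n r)) x) =
    algebraMap K L (δ k x)
  D_gen : ∀ k α (hα : α ∈ GamPred m n r),
    D k ⟨a α, IntermediateField.subset_adjoin K _ (Set.mem_image_of_mem a hα)⟩ =
      a (α.1 + unit k, α.2)

section

variable {m : ℕ} {K : Type u} [Field K] {δ : Fin m → Derivation ℤ K K} {n r s : ℕ}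

/-- `P'` is a prolongation of `P` of length `s ≥ r`: `L'` is a field extension of `L` (by means of
`ι`) with the same generators `a^ξ_i` for `(ξ, i) ∈ Γ(r)`, and each `D'_k` extends `D_k`. (Since
`ι` preserves the generators, it maps the domain of `D_k` into that of `D'_k`.) -/
def IsProlongation {L L' : Type u} [Field L] [Algebra K L] [Field L'] [Algebra K L']
    (P : DifferentialKernel δ n r L) (P' : DifferentialKernel δ n s L') : Prop :=
  r ≤ s ∧ ∃ ι : L →ₐ[K] L',
    (∀ α ∈ Gam m n r, ι (P.a α) = P'.a α) ∧
    ∀ (k : Fin m) (x : IntermediateField.adjoin K (P.a '' GamPred m n r))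
      (y : IntermediateField.adjoin K (P'.a '' GamPred m n s)),
      (y : L') = ι (x : L) → P'.D k y = ι (P.D k x)

/-- `P` has a prolongation of length `s`. -/
def HasProlongation {L : Type u} [Field L] [Algebra K L]
    (P : DifferentialKernel δ n r L) (s : ℕ) : Prop :=
  ∃ (L' : Type u) (_ : Field L') (_ : Algebra K L') (P' : DifferentialKernel δ n s L'),
    IsProlongation P P'

/-- `P` has a regular realization: there are a differential field extension `(M, ∂)` of `(K, δ)`,
with commuting derivations, and a tuple `g = (g_1, …, g_n)` in `M` such that
`a^ξ_i ↦ ∂^ξ g_i` defines a `K`-isomorphism of `L` onto `K(∂^ξ g_i : (ξ, i) ∈ Γ(r))`. -/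
def HasRegularRealization {L : Type u} [Field L] [Algebra K L]
    (P : DifferentialKernel δ n r L) : Prop :=
  ∃ (M : Type u) (_ : Field M) (_ : Algebra K M) (d : Fin m → Derivation ℤ M M) (g : Fin n → M),
    Commuting d ∧
    (∀ k x, d k (algebraMap K M x) = algebraMap K M (δ k x)) ∧
    ∃ φ : L ≃ₐ[K] IntermediateField.adjoin K
        ((fun α : Idx m n => iterDeriv d α.1 (g α.2)) '' Gam m n r),
      ∀ α ∈ Gam m n r, (φ (P.a α) : M) = iterDeriv d α.1 (g α.2)

end

/-- Every differential kernel of length `r` in `n` indeterminates, over any differential field of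
characteristic zero with `m` commuting derivations, which has a prolongation of length `t` has a
regular realization. (A kernel and a prolongation are finitely generated over `K`, so every one is
isomorphic to one in the universe of `K`.) -/
def ProlongationSuffices (r m n t : ℕ) : Prop :=
  ∀ (K : Type u) [Field K] [CharZero K] (δ : Fin m → Derivation ℤ K K), Commuting δ →
    ∀ (L : Type u) [Field L] [Algebra K L] (P : DifferentialKernel δ n r L),
      HasProlongation P t → HasRegularRealization P

/-- `T_{r,m}^n`, the smallest integer `t ≥ r` such that having a prolongation of length `t`
suffices for a differential kernel of length `r` to have a regular realization (`∞` if there were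
none). -/
noncomputable def T (r m n : ℕ) : ℕ∞ :=
  ⨅ (t : ℕ) (_ : r ≤ t ∧ ProlongationSuffices.{u} r m n t), (t : ℕ∞)

end DiffKer

/-! The upper bounds come from counting monomials. For a set `G` of generators, `layer G p` consists
of the monomials of degree `p` in the ideal generated by the elements of `G` of degree at most `p`.
Call a level `p` good if this ideal satisfies `NoIsolated p`. In two or three variables a good level
satisfies `DirConnected`: directions `i`, `j` with `τ - 𝐢`, `τ - 𝐣` in the ideal are linked through
`τ - 𝐢 - 𝐣` or through one third direction. Induction on the degree of `τ` turns these links into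
chains of generators (`reflTransGen_linked`), so `C ≤ t` as soon as every `G` has a good level in
`[r, t]`.

A bad level makes the layers grow too fast. If level `r` is bad, its layer has at least two
elements. In two variables each further bad level adds at least two monomials, while the number of
all monomials of a degree grows by one; the room is exhausted at `2 r`. In three variables the
isoperimetric inequality `card_le_of_card_shadow` shows that at a bad level a layer with more than
`M (M + 1) / 2` elements grows by at least `M + 3`, one more than the full triangle with `(M + 1)(M
+ 2) / 2` points does. The excess accumulates until the layer would have to exceed the set of all
monomials; each increase of the comparison triangle relative to the degree doubles the bound, whence
`3 (2 ^ r - 1)`.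

For the lower bounds, explicit antichains have, for every `p` in `[r, t)`, two generators of degree
at most `p` whose least upper bound has degree `p + 1` and lies above no other generator.

For `T`, fix an orderly ranking and call an index a leader if its generator in the prolongation is
algebraic over those of lower rank. At a level `p` where the ideal of leaders is `DirConnected`,
everything above degree `p` is discarded and rebuilt rank by rank: a nonleader receives a new
transcendental, a leader the derivative of a lower leader. By `DirConnected` this derivative does
not depend on the choice. -/

/-! ### Derivations of fields of characteristic zero. -/

theorem formallySmooth_of_charZero (K L : Type*) [Field K] [Field L] [Algebra K L] [CharZero K] :
    Algebra.FormallySmooth K L := by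
  obtain ⟨s, hs⟩ := exists_isTranscendenceBasis K L
  have : Algebra.IsAlgebraic (IntermediateField.adjoin K (Set.range ((↑) : s → L))) L :=
    hs.isAlgebraic_field
  exact .of_algebraicIndependent_of_isSeparable hs.1

theorem formallySmooth_of_injective (A M : Type*) [CommRing A] [IsDomain A] [Field M] [CharZero M]
    [Algebra A M] [FaithfulSMul A M] : Algebra.FormallySmooth A M := by
  let : Algebra (FractionRing A) M := FractionRing.liftAlgebra A M
  have : IsScalarTower A (FractionRing A) M := FractionRing.isScalarTower_liftAlgebra A M
  have : CharZero (FractionRing A) :=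
    ((algebraMap (FractionRing A) M).charZero_iff
      (FaithfulSMul.algebraMap_injective (FractionRing A) M)).2 inferInstance
  have := formallySmooth_of_charZero (FractionRing A) M
  have : Algebra.FormallySmooth A (FractionRing A) := .of_isLocalization (nonZeroDivisors A)
  exact .comp A (FractionRing A) M

/-- The map `a ↦ a + D(a) ε` makes the dual numbers `M[ε]` an `A`-algebra. Formal smoothness lifts
the identity of `M` through `M[ε] → M`, whose kernel has square zero; the `ε`-component of the lift
is the extension. -/
theorem exists_derivation_extension {A M : Type*} [CommRing A] [IsDomain A] [Field M] [CharZero M]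
    [Algebra A M] [FaithfulSMul A M] (D : Derivation ℤ A M) :
    ∃ D' : Derivation ℤ M M, ∀ a, D' (algebraMap A M a) = D a := by
  have hs := formallySmooth_of_injective A M
  let φ : A →+* TrivSqZeroExt M M :=
    { toFun := fun a => TrivSqZeroExt.inl (algebraMap A M a) + TrivSqZeroExt.inr (D a)
      map_one' := by simp
      map_zero' := by simp
      map_add' := fun x y => by ext <;> simp
      map_mul' := fun x y => by
        ext
        · simp
        · simp only [Derivation.leibniz, map_mul, TrivSqZeroExt.snd_add, TrivSqZeroExt.snd_inl,
            TrivSqZeroExt.snd_inr, TrivSqZeroExt.snd_mul, TrivSqZeroExt.fst_add,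
            TrivSqZeroExt.fst_inl, TrivSqZeroExt.fst_inr, Algebra.smul_def,
            MulOpposite.smul_eq_mul_unop, MulOpposite.unop_op]
          simp
          ring }
  let : Algebra A (TrivSqZeroExt M M) := φ.toAlgebra
  let f : TrivSqZeroExt M M →ₐ[A] M :=
    { (TrivSqZeroExt.fstHom ℤ M M).toRingHom with
      commutes' := fun a => by
        change TrivSqZeroExt.fst (TrivSqZeroExt.inl (algebraMap A M a) + TrivSqZeroExt.inr (D a)) = _
        simp }
  have hf : ∀ x, f x = x.fst := fun x => rfl
  have hnil : IsNilpotent (RingHom.ker (f : TrivSqZeroExt M M →+* M)) := by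
    refine ⟨2, ?_⟩
    rw [show ∀ I : Ideal (TrivSqZeroExt M M), I ^ 2 = I * I from fun I => pow_two I,
      Ideal.zero_eq_bot, eq_bot_iff, Ideal.mul_le]
    intro x hx y hy
    have hx' : x.fst = 0 := hx
    have hy' : y.fst = 0 := hy
    rw [Ideal.mem_bot]
    ext <;> simp [hx', hy']
  have hsurj : Function.Surjective f := fun x => ⟨.inl x, by simp [hf]⟩
  let g : M →ₐ[A] TrivSqZeroExt M M :=
    Algebra.FormallySmooth.liftOfSurjective (AlgHom.id A M) f hsurj hnil
  have hg : ∀ x, (g x).fst = x := fun x =>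
    Algebra.FormallySmooth.liftOfSurjective_apply (AlgHom.id A M) f hsurj hnil x
  refine ⟨Derivation.mk' ((TrivSqZeroExt.sndHom M M).toAddMonoidHom.comp
    (g : M →+* TrivSqZeroExt M M).toAddMonoidHom).toIntLinearMap ?_, fun a => ?_⟩
  · intro a b
    change (g (a * b)).snd = a • (g b).snd + b • (g a).snd
    simp [hg, mul_comm]
  · change (g (algebraMap A M a)).snd = D a
    rw [g.commutes]
    change TrivSqZeroExt.snd (TrivSqZeroExt.inl (algebraMap A M a) + TrivSqZeroExt.inr (D a)) = _
    simp

open Polynomial in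
-- This is `c · d/dX` on the polynomial ring `F[x]`, extended to `M`.
theorem exists_derivation_of_transcendental {K M : Type*} [Field K] [Field M] [CharZero M]
    [Algebra K M] (F : IntermediateField K M) {x : M} (hx : Transcendental F x) (c : M) :
    ∃ D : Derivation ℤ M M, (∀ y ∈ F, D y = 0) ∧ D x = c := by
  let : Algebra F[X] M := (aeval x : F[X] →ₐ[F] M).toAlgebra
  have : IsScalarTower F F[X] M := IsScalarTower.of_algebraMap_eq' (aeval x).comp_algebraMap.symm
  have : FaithfulSMul F[X] M := (faithfulSMul_iff_algebraMap_injective _ _).2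
    (transcendental_iff_injective.1 hx)
  obtain ⟨D, hD⟩ := exists_derivation_extension ((mkDerivation F c).restrictScalars ℤ)
  refine ⟨D, fun y hy => ?_, ?_⟩
  · have h : algebraMap F[X] M (C ⟨y, hy⟩) = y := aeval_C x _
    rw [← h, hD]
    exact Derivation.map_algebraMap (mkDerivation F c) _
  · have h : algebraMap F[X] M X = x := aeval_X x
    rw [← h, hD]
    exact mkDerivation_X (R := F) c

open Polynomial in
-- The term `e` comes from differentiating the coefficients. With `S` an arbitrary additive
-- subgroup, one computation serves both for membership in a field and for vanishing.
theorem derivation_aeval_eq {K M : Type*} [Field K] [Field M] [Algebra K M]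
    {F : IntermediateField K M} (S : AddSubgroup M) (D : Derivation ℤ M M) {x : M}
    (hD : ∀ y ∈ F, ∀ n : ℕ, x ^ n * D y ∈ S) (p : F[X]) :
    ∃ e ∈ S, D (aeval x p) = e + aeval x (derivative p) * D x := by
  induction p using Polynomial.induction_on' with
  | add p q hp hq =>
    obtain ⟨e, he, h⟩ := hp
    obtain ⟨e', he', h'⟩ := hq
    refine ⟨e + e', S.add_mem he he', ?_⟩
    simp only [map_add, h, h', add_mul]
    ring
  | monomial n a =>
    refine ⟨_, hD a a.2 n, ?_⟩
    simp only [aeval_monomial, Derivation.leibniz, Derivation.leibniz_pow, smul_eq_mul,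
      derivative_monomial, map_mul, map_natCast, nsmul_eq_mul]
    change (a : M) * _ + x ^ n * D (a : M) = x ^ n * D a + (a : M) * n * x ^ (n - 1) * D x
    ring

open Polynomial in
-- Differentiate the equation given by the minimal polynomial; by separability its derivative does
-- not vanish at `x`.
theorem exists_derivation_mul_eq {K M : Type*} [Field K] [Field M] [CharZero M]
    [Algebra K M] {F : IntermediateField K M} (S : AddSubgroup M) (D : Derivation ℤ M M) {x : M}
    (hD : ∀ y ∈ F, ∀ n : ℕ, x ^ n * D y ∈ S) (hx : IsAlgebraic F x) :
    ∃ e ∈ S, ∃ p : F[X], aeval x p ≠ 0 ∧ aeval x p * D x = e := by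
  obtain ⟨e, he, h⟩ := derivation_aeval_eq S D hD (minpoly F x)
  have : CharZero F := (algebraMap F M).charZero_iff (algebraMap F M).injective |>.2 inferInstance
  refine ⟨-e, S.neg_mem he, derivative (minpoly F x), ?_, ?_⟩
  · exact (minpoly.irreducible hx.isIntegral).separable.aeval_derivative_ne_zero (minpoly.aeval F x)
  · rw [minpoly.aeval, map_zero] at h
    linear_combination -h

/-- A derivation maps an element that is algebraic over `F` into any field containing it, `F` and
the image of `F`. -/
theorem derivation_mem_of_isAlgebraic {K M : Type*} [Field K] [Field M] [CharZero M]
    [Algebra K M] {F E : IntermediateField K M} (hFE : F ≤ E) (D : Derivation ℤ M M)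
    (hD : ∀ y ∈ F, D y ∈ E) {x : M} (hxE : x ∈ E) (hx : IsAlgebraic F x) : D x ∈ E := by
  obtain ⟨e, he, p, hp, h⟩ := exists_derivation_mul_eq E.toSubfield.toAddSubgroup D
    (fun y hy n => E.mul_mem (pow_mem hxE n) (hD y hy)) hx
  rw [mul_comm, ← eq_div_iff hp] at h
  rw [h]
  refine div_mem he ?_
  rw [Polynomial.aeval_eq_sum_range]
  exact sum_mem fun i _ => E.mul_mem (hFE (p.coeff i).2) (pow_mem hxE i)

theorem derivation_eq_zero_of_isAlgebraic {K M : Type*} [Field K] [Field M] [CharZero M]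
    [Algebra K M] {F : IntermediateField K M} (D : Derivation ℤ M M)
    (hD : ∀ y ∈ F, D y = 0) {x : M} (hx : IsAlgebraic F x) : D x = 0 := by
  obtain ⟨e, he, p, hp, h⟩ := exists_derivation_mul_eq ⊥ D
    (fun y hy n => by simp [hD y hy]) hx
  rw [AddSubgroup.mem_bot] at he
  rw [he] at h
  exact (mul_eq_zero.1 h).resolve_left hp

/-- The field generated by `S`, the values of a derivation on which are controlled by its values on
`S` and on the base field. -/
theorem derivation_mem_of_mem_adjoin {K M : Type*} [Field K] [Field M] [Algebra K M]
    {S : Set M} {E : IntermediateField K M} (D : Derivation ℤ M M)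
    (hK : ∀ x, D (algebraMap K M x) ∈ E) (hSE : ∀ x ∈ S, x ∈ E) (hS : ∀ x ∈ S, D x ∈ E)
    {y : M} (hy : y ∈ IntermediateField.adjoin K S) : D y ∈ E := by
  have hle : IntermediateField.adjoin K S ≤ E := IntermediateField.adjoin_le_iff.2 hSE
  induction hy using IntermediateField.adjoin_induction with
  | mem x hx => exact hS x hx
  | algebraMap x => exact hK x
  | add x y _ _ hx hy => rw [map_add]; exact add_mem hx hy
  | inv x hx' hx =>
    rw [Derivation.leibniz_inv]
    exact E.mul_mem (neg_mem (pow_mem (E.inv_mem (hle hx')) 2)) hx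
  | mul x y hx' hy' hx hy =>
    rw [Derivation.leibniz]
    exact add_mem (E.mul_mem (hle hx') hy) (E.mul_mem (hle hy') hx)

theorem derivation_eqOn_adjoin {K M N : Type*} [Field K] [Field M] [Field N] [Algebra K M]
    [Algebra M N] {S : Set M} (D D' : Derivation ℤ M N)
    (hK : ∀ x, D (algebraMap K M x) = D' (algebraMap K M x)) (hS : ∀ x ∈ S, D x = D' x)
    {y : M} (hy : y ∈ IntermediateField.adjoin K S) : D y = D' y := by
  induction hy using IntermediateField.adjoin_induction with
  | mem x hx => exact hS x hx
  | algebraMap x => exact hK x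
  | add x y _ _ hx hy => rw [map_add, map_add, hx, hy]
  | inv x _ hx => rw [Derivation.leibniz_inv, Derivation.leibniz_inv, hx]
  | mul x y _ _ hx hy => rw [Derivation.leibniz, Derivation.leibniz, hx, hy]

open scoped IntermediateField.algebraAdjoinAdjoin in
/-- A purely transcendental extension in infinitely many variables contains elements transcendental
over every finitely generated subfield. -/
theorem exists_transcendental_adjoin_finite (K L : Type*) [Field K] [Field L] [Algebra K L]
    {S : Set (FractionRing (MvPolynomial ℕ L))} (hS : S.Finite) :
    ∃ x : FractionRing (MvPolynomial ℕ L),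
      Transcendental (IntermediateField.adjoin K S) x := by
  by_contra! h
  have hal : Algebra.IsAlgebraic (IntermediateField.adjoin K S)
      (FractionRing (MvPolynomial ℕ L)) := ⟨fun x => not_not.1 (h x)⟩
  have : Algebra.IsAlgebraic (Algebra.adjoin K S) (IntermediateField.adjoin K S) :=
    IsLocalization.isAlgebraic _ (nonZeroDivisors (Algebra.adjoin K S))
  have : Algebra.IsAlgebraic (Algebra.adjoin K S) (FractionRing (MvPolynomial ℕ L)) :=
    .trans _ (IntermediateField.adjoin K S) _
  have h1 : Algebra.trdeg K (FractionRing (MvPolynomial ℕ L)) ≤ Cardinal.mk S :=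
    Algebra.IsAlgebraic.trdeg_le_cardinalMk K S
  have hX : AlgebraicIndependent K (fun n : ℕ => algebraMap (MvPolynomial ℕ L)
      (FractionRing (MvPolynomial ℕ L)) (MvPolynomial.X n)) := by
    refine AlgebraicIndependent.restrictScalars (K := L) (algebraMap K L).injective ?_
    exact (MvPolynomial.algebraicIndependent_X ℕ L).map' (f := IsScalarTower.toAlgHom L _ _)
      (IsFractionRing.injective _ _)
  have h2 := hX.lift_cardinalMk_le_trdeg
  have h3 : Cardinal.mk S < Cardinal.aleph0 := Cardinal.lt_aleph0_iff_set_finite.2 hS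
  have h4 := h1.trans_lt h3
  rw [Cardinal.mk_nat, Cardinal.lift_aleph0] at h2
  have h5 := h2.trans_lt (Cardinal.lift_lt_aleph0.2 h4)
  exact lt_irrefl _ h5

namespace DiffKer

/-! ### Monomials, monomial ideals, cones and shadows. -/

section Basic

variable {m : ℕ}

theorem deg_add (ξ τ : Fin m → ℕ) : deg (ξ + τ) = deg ξ + deg τ := by
  simp [deg, Finset.sum_add_distrib]

theorem deg_unit (k : Fin m) : deg (unit k) = 1 := by
  simp [deg, unit]

theorem deg_add_unit (ξ : Fin m → ℕ) (k : Fin m) : deg (ξ + unit k) = deg ξ + 1 := by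
  rw [deg_add, deg_unit]

theorem deg_mono {ξ τ : Fin m → ℕ} (h : ξ ≤ τ) : deg ξ ≤ deg τ :=
  Finset.sum_le_sum fun k _ => h k

theorem apply_le {ξ τ : Fin m → ℕ} (h : ξ ≤ τ) (k : Fin m) : ξ k ≤ τ k := h k

theorem eq_of_le_of_deg_le {ξ τ : Fin m → ℕ} (h : ξ ≤ τ) (hd : deg τ ≤ deg ξ) : ξ = τ := by
  have h1 : ∑ k, ξ k = ∑ k, τ k := le_antisymm (deg_mono h) hd
  exact funext fun k => (Finset.sum_eq_sum_iff_of_le fun k _ => h k).1 h1 k (Finset.mem_univ k)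

theorem add_unit_same (ξ : Fin m → ℕ) (k : Fin m) : (ξ + unit k) k = ξ k + 1 := by
  simp [unit]

theorem add_unit_ne (ξ : Fin m → ℕ) {k l : Fin m} (h : l ≠ k) : (ξ + unit k) l = ξ l := by
  simp [unit, h]

theorem le_add_unit (ξ : Fin m → ℕ) (k : Fin m) : ξ ≤ ξ + unit k := by
  intro l; simp

theorem exists_add_unit_eq {τ : Fin m → ℕ} {k : Fin m} (h : 1 ≤ τ k) : ∃ θ, θ + unit k = τ := by
  refine ⟨τ - unit k, tsub_add_cancel_of_le ?_⟩
  intro l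
  by_cases hl : l = k
  · subst hl; simpa [unit] using h
  · simp [unit, hl]

theorem le_of_le_add_unit {β θ : Fin m → ℕ} {k : Fin m} (h : β ≤ θ + unit k) (hk : β k ≤ θ k) :
    β ≤ θ := by
  intro l
  by_cases hl : l = k
  · subst hl; exact hk
  · have := h l
    rwa [add_unit_ne _ hl] at this

theorem add_unit_le_of_lt {β θ : Fin m → ℕ} {k : Fin m} (h : β ≤ θ) (hk : β k < θ k) :
    β + unit k ≤ θ := by
  intro l
  by_cases hl : l = k
  · subst hl; rw [add_unit_same]; exact hk
  · rw [add_unit_ne _ hl]; exact h l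

theorem exists_lt_of_deg_lt {β τ : Fin m → ℕ} (hd : deg β < deg τ) :
    ∃ k, β k < τ k := by
  by_contra! hc
  exact absurd (deg_mono (show τ ≤ β from hc)) (by omega)

/-- A tuple of degree at least that of `β` strictly above `β` can be lowered in one position. -/
theorem exists_pred {β τ : Fin m → ℕ} (h : β ≤ τ) (hd : deg β < deg τ) :
    ∃ k θ, θ + unit k = τ ∧ β ≤ θ := by
  obtain ⟨k, hk⟩ := exists_lt_of_deg_lt hd
  obtain ⟨θ, rfl⟩ := exists_add_unit_eq (show 1 ≤ τ k by omega)
  rw [add_unit_same] at hk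
  exact ⟨k, θ, rfl, le_of_le_add_unit h (by omega)⟩

theorem exists_between {β τ : Fin m → ℕ} (h : β ≤ τ) {d : ℕ} (h1 : deg β ≤ d)
    (h2 : d ≤ deg τ) : ∃ μ, β ≤ μ ∧ μ ≤ τ ∧ deg μ = d := by
  induction hn : deg τ - d generalizing τ with
  | zero => exact ⟨τ, h, le_rfl, by omega⟩
  | succ n ih =>
    obtain ⟨k, θ, rfl, hθ⟩ := exists_pred h (by omega)
    rw [deg_add_unit] at hn h2
    obtain ⟨μ, h3, h4, h5⟩ := ih hθ (by omega) (by omega)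
    exact ⟨μ, h3, h4.trans (le_add_unit θ k), h5⟩

/-- The monomial ideal generated by `S`: all tuples above some element of `S`. -/
def up (S : Set (Fin m → ℕ)) : Set (Fin m → ℕ) := {τ | ∃ β ∈ S, β ≤ τ}

theorem subset_up (S : Set (Fin m → ℕ)) : S ⊆ up S := fun β hβ => ⟨β, hβ, le_rfl⟩

theorem up_mono {S T : Set (Fin m → ℕ)} (h : S ⊆ T) : up S ⊆ up T :=
  fun _ ⟨β, hβ, hle⟩ => ⟨β, h hβ, hle⟩

theorem mem_up_of_le {S : Set (Fin m → ℕ)} {ξ τ : Fin m → ℕ} (h : ξ ∈ up S) (hle : ξ ≤ τ) :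
    τ ∈ up S := by
  obtain ⟨β, hβ, h'⟩ := h
  exact ⟨β, hβ, h'.trans hle⟩

theorem mem_of_mem_up {S : Set (Fin m → ℕ)} {d : ℕ} (hS : ∀ u ∈ S, deg u = d) {τ : Fin m → ℕ}
    (h : τ ∈ up S) (hd : deg τ = d) : τ ∈ S := by
  obtain ⟨β, hβ, hle⟩ := h
  rwa [← eq_of_le_of_deg_le hle (by rw [hd, hS β hβ])]

theorem exists_pred_mem_up {S : Set (Fin m → ℕ)} {d : ℕ} (hS : ∀ u ∈ S, deg u = d)
    {τ : Fin m → ℕ} (h : τ ∈ up S) (hd : d < deg τ) : ∃ k, ∃ θ ∈ up S, θ + unit k = τ := by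
  obtain ⟨β, hβ, hle⟩ := h
  obtain ⟨k, θ, h1, h2⟩ := exists_pred hle (by rw [hS β hβ]; exact hd)
  exact ⟨k, θ, ⟨β, hβ, h2⟩, h1⟩

/-- In degrees above `p`, the monomial ideal `I` has no isolated directions: if `τ - 𝐢` and
`τ - 𝐣` lie in `I`, then so does `τ - 𝐢 - 𝐥` for some `l ≠ i`. -/
def NoIsolated (p : ℕ) (I : Set (Fin m → ℕ)) : Prop :=
  ∀ β ∈ I, ∀ β' ∈ I, ∀ i j, i ≠ j → β + unit i = β' + unit j → p ≤ deg β →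
    ∃ l, l ≠ i ∧ ∃ θ ∈ I, θ + unit l = β

/-- The witness `θ` has degree one less than `β`, so the ideals must agree already from degree `p`
on. -/
theorem NoIsolated.congr {p : ℕ} {I I' : Set (Fin m → ℕ)} (h : NoIsolated (p + 1) I)
    (hI : ∀ τ, p ≤ deg τ → (τ ∈ I ↔ τ ∈ I')) : NoIsolated (p + 1) I' := by
  intro β hβ β' hβ' i j hij he hd
  have hd' : deg β' = deg β := by
    have := congrArg deg he
    rw [deg_add_unit, deg_add_unit] at this
    omega
  obtain ⟨l, hl, θ, hθ, rfl⟩ := h β ((hI β (by omega)).2 hβ) β' ((hI β' (by omega)).2 hβ') i j hij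
    he hd
  rw [deg_add_unit] at hd
  exact ⟨l, hl, θ, (hI θ (by omega)).1 hθ, rfl⟩

theorem apply_eq_of_add_unit_eq {β β' : Fin m → ℕ} {i j : Fin m} (hij : i ≠ j)
    (h : β + unit i = β' + unit j) : β j = β' j + 1 := by
  have := congrFun h j
  rwa [add_unit_ne _ hij.symm, add_unit_same] at this

/-- In these degrees the ideal is principal. Both `β` and `β'` are multiples of `γ` and `β j = β' j
+ 1`, so direction `j` can be removed from `β`. -/
theorem noIsolated_of_forall_le {p : ℕ} {I : Set (Fin m → ℕ)} (γ : Fin m → ℕ)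
    (h : ∀ τ ∈ I, p ≤ deg τ → γ ≤ τ) (h' : ∀ τ, γ ≤ τ → p ≤ deg τ + 1 → τ ∈ I) :
    NoIsolated p I := by
  intro β hβ β' hβ' i j hij he hd
  have hd' : deg β' = deg β := by
    have := congrArg deg he
    rw [deg_add_unit, deg_add_unit] at this
    omega
  have hj := apply_eq_of_add_unit_eq hij he
  obtain ⟨θ, rfl⟩ := exists_add_unit_eq (show 1 ≤ β j by omega)
  refine ⟨j, hij.symm, θ, h' θ (le_of_le_add_unit (h _ hβ hd) ?_) (by rwa [← deg_add_unit θ j]), rfl⟩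
  have hγ : γ j ≤ β' j := h _ hβ' (by omega) j
  rw [add_unit_same] at hj
  omega

/-- The multiples of `γ` of degree `deg γ + t`. -/
def cone (γ : Fin m → ℕ) (t : ℕ) : Finset (Fin m → ℕ) :=
  (Finset.Nat.antidiagonalTuple m t).image (γ + ·)

theorem mem_cone {γ μ : Fin m → ℕ} {t : ℕ} : μ ∈ cone γ t ↔ γ ≤ μ ∧ deg μ = deg γ + t := by
  simp only [cone, Finset.mem_image, Finset.Nat.mem_antidiagonalTuple]
  constructor
  · rintro ⟨x, hx, rfl⟩
    exact ⟨le_self_add, by rw [deg_add, ← hx]; rfl⟩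
  · rintro ⟨h, hd⟩
    obtain ⟨x, rfl⟩ := exists_add_of_le h
    rw [deg_add] at hd
    exact ⟨x, by unfold deg at hd; omega, rfl⟩

theorem card_cone (γ : Fin m → ℕ) (t : ℕ) :
    (cone γ t).card = (Finset.Nat.antidiagonalTuple m t).card :=
  Finset.card_image_of_injective _ (add_right_injective γ)

theorem card_antidiagonalTuple_two (t : ℕ) : (Finset.Nat.antidiagonalTuple 2 t).card = t + 1 := by
  rw [Finset.Nat.antidiagonalTuple_two]
  simp

theorem card_antidiagonalTuple_three (t : ℕ) :
    2 * (Finset.Nat.antidiagonalTuple 3 t).card = (t + 1) * (t + 2) := by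
  have h : (Finset.Nat.antidiagonalTuple 3 t).card =
      ((List.Nat.antidiagonal t).map fun q => q.2 + 1).sum := by
    change (List.Nat.antidiagonalTuple 3 t).length = _
    rw [List.Nat.antidiagonalTuple, List.length_flatMap]
    congr 2
    funext q
    rw [List.length_map]
    exact card_antidiagonalTuple_two q.2
  rw [h]
  clear h
  induction t with
  | zero => simp
  | succ t ih =>
    rw [List.Nat.antidiagonal_succ, List.map_cons, List.sum_cons, List.map_map]
    have h : ((fun q : ℕ × ℕ => q.2 + 1) ∘ Prod.map Nat.succ id) = fun q => q.2 + 1 := rfl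
    rw [h, mul_add, ih]
    ring

/-- The multiples of the elements of `J` by one variable. -/
def shadow (J : Finset (Fin m → ℕ)) : Finset (Fin m → ℕ) :=
  Finset.univ.biUnion fun k => J.image (· + unit k)

theorem mem_shadow {J : Finset (Fin m → ℕ)} {x : Fin m → ℕ} :
    x ∈ shadow J ↔ ∃ u ∈ J, ∃ k, u + unit k = x := by
  simp only [shadow, Finset.mem_biUnion, Finset.mem_univ, true_and, Finset.mem_image]
  exact ⟨fun ⟨k, u, h, e⟩ => ⟨u, h, k, e⟩, fun ⟨u, h, k, e⟩ => ⟨k, u, h, e⟩⟩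

theorem add_unit_mem_shadow {J : Finset (Fin m → ℕ)} {u : Fin m → ℕ} (h : u ∈ J) (k : Fin m) :
    u + unit k ∈ shadow J :=
  mem_shadow.2 ⟨u, h, k, rfl⟩

theorem shadow_mono {J J' : Finset (Fin m → ℕ)} (h : J ⊆ J') : shadow J ⊆ shadow J' := by
  intro x hx
  obtain ⟨u, hu, k, rfl⟩ := mem_shadow.1 hx
  exact add_unit_mem_shadow (h hu) k

theorem shadow_union (A B : Finset (Fin m → ℕ)) : shadow (A ∪ B) = shadow A ∪ shadow B := by
  ext x
  simp only [mem_shadow, Finset.mem_union, or_and_right, exists_or]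

theorem shadow_cone (γ : Fin m → ℕ) (t : ℕ) : shadow (cone γ t) = cone γ (t + 1) := by
  ext x
  rw [mem_shadow, mem_cone]
  constructor
  · rintro ⟨u, hu, k, rfl⟩
    obtain ⟨h1, h2⟩ := mem_cone.1 hu
    exact ⟨h1.trans (le_add_unit u k), by rw [deg_add_unit, h2]; ring⟩
  · rintro ⟨h1, h2⟩
    obtain ⟨k, θ, rfl, hθ⟩ := exists_pred h1 (by omega)
    rw [deg_add_unit] at h2
    exact ⟨θ, mem_cone.2 ⟨hθ, by omega⟩, k, rfl⟩

theorem mem_up_cone {γ : Fin m → ℕ} {t : ℕ} {τ : Fin m → ℕ} :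
    τ ∈ up (cone γ t : Set (Fin m → ℕ)) ↔ γ ≤ τ ∧ deg γ + t ≤ deg τ := by
  constructor
  · rintro ⟨β, hβ, hle⟩
    obtain ⟨h1, h2⟩ := mem_cone.1 hβ
    exact ⟨h1.trans hle, h2 ▸ deg_mono hle⟩
  · rintro ⟨h1, h2⟩
    obtain ⟨μ, h3, h4, h5⟩ := exists_between h1 (Nat.le_add_right _ t) h2
    exact ⟨μ, mem_cone.2 ⟨h3, h5⟩, h4⟩

theorem noIsolated_up_cone (γ : Fin m → ℕ) (t : ℕ) :
    NoIsolated (deg γ + t + 1) (up (cone γ t : Set (Fin m → ℕ))) :=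
  noIsolated_of_forall_le γ (fun _ h _ => (mem_up_cone.1 h).1)
    fun _ h h' => mem_up_cone.2 ⟨h, by omega⟩

/-- The graph on `J`, in which two monomials are adjacent if they have a common multiple by one
variable each, is connected. -/
def ShadowConnected (J : Finset (Fin m → ℕ)) : Prop :=
  ∀ A B : Finset (Fin m → ℕ), A.Nonempty → B.Nonempty → A ∪ B = J → ¬ Disjoint (shadow A) (shadow B)

theorem shadowConnected_insert {J : Finset (Fin m → ℕ)} (h : ShadowConnected J) {u v : Fin m → ℕ}
    (hu : u ∈ J) {k l : Fin m} (huv : u + unit k = v + unit l) : ShadowConnected (insert v J) := by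
  have key : ∀ A B : Finset (Fin m → ℕ), A.Nonempty → B.Nonempty → A ∪ B = insert v J →
      A ∩ J = ∅ → ¬ Disjoint (shadow A) (shadow B) := by
    intro A B hA _ hAB he
    obtain ⟨a, ha⟩ := hA
    have hav : a = v := by
      have : a ∈ insert v J := hAB ▸ Finset.mem_union_left B ha
      refine (Finset.mem_insert.1 this).resolve_right fun hJ => ?_
      exact Finset.notMem_empty a (he ▸ Finset.mem_inter.2 ⟨ha, hJ⟩)
    have huB : u ∈ B := by
      have : u ∈ A ∪ B := hAB ▸ Finset.mem_insert_of_mem hu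
      refine (Finset.mem_union.1 this).resolve_left fun hA => ?_
      exact Finset.notMem_empty u (he ▸ Finset.mem_inter.2 ⟨hA, hu⟩)
    rw [Finset.not_disjoint_iff]
    exact ⟨v + unit l, add_unit_mem_shadow (hav ▸ ha) l, huv ▸ add_unit_mem_shadow huB k⟩
  intro A B hA hB hAB
  by_cases hA' : A ∩ J = ∅
  · exact key A B hA hB hAB hA'
  by_cases hB' : B ∩ J = ∅
  · rw [disjoint_comm]
    exact key B A hB hA (by rw [Finset.union_comm, hAB]) hB'
  have := h (A ∩ J) (B ∩ J) (Finset.nonempty_iff_ne_empty.2 hA') (Finset.nonempty_iff_ne_empty.2 hB')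
    (by rw [← Finset.union_inter_distrib_right, hAB]
        exact Finset.inter_eq_right.2 (Finset.subset_insert v J))
  exact fun hd => this (hd.mono (shadow_mono Finset.inter_subset_left)
    (shadow_mono Finset.inter_subset_left))

end Basic

/-! ### Triangle-closed connected sets in three variables are cones. -/

section ThreeVariables

theorem eq_or_eq_or_eq_of_distinct {a b c : Fin 3} (hab : a ≠ b) (hac : a ≠ c) (hbc : b ≠ c)
    (k : Fin 3) : k = a ∨ k = b ∨ k = c := by
  omega

theorem deg_eq_of_distinct {a b c : Fin 3} (hab : a ≠ b) (hac : a ≠ c) (hbc : b ≠ c)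
    (ξ : Fin 3 → ℕ) : deg ξ = ξ a + ξ b + ξ c := by
  have : (Finset.univ : Finset (Fin 3)) = {a, b, c} := by
    ext k
    simpa using eq_or_eq_or_eq_of_distinct hab hac hbc k
  rw [deg, this, Finset.sum_insert (by simp [hab, hac]), Finset.sum_insert (by simp [hbc]),
    Finset.sum_singleton, add_assoc]

theorem exists_distinct (b : Fin 3) : ∃ a c : Fin 3, a ≠ b ∧ a ≠ c ∧ b ≠ c := by
  revert b; decide

/-- `J` contains the third vertex of each triangle `{ν + 𝐚, ν + 𝐛, ν + 𝐜}` of which it contains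
two. -/
def TriangleClosed (J : Finset (Fin 3 → ℕ)) : Prop :=
  ∀ (ν : Fin 3 → ℕ) (a b c : Fin 3), a ≠ b → a ≠ c → b ≠ c → ν + unit a ∈ J → ν + unit b ∈ J →
    ν + unit c ∈ J

/-- A triangle-closed set that contains a triangular cone, and a point on the line next to one of
its sides, contains the cone enlarged by that line. -/
theorem TriangleClosed.cone_subset {J : Finset (Fin 3 → ℕ)} (hJ : TriangleClosed J)
    {γ v : Fin 3 → ℕ} {b : Fin 3} {t : ℕ} (hQ : cone (γ + unit b) t ⊆ J) (hv : v ∈ J)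
    (hvγ : v ∈ cone γ (t + 1)) (hvb : v b = γ b) : cone γ (t + 1) ⊆ J := by
  obtain ⟨a, c, hab, hac, hbc⟩ := exists_distinct b
  have hdeg := deg_eq_of_distinct hab hac hbc
  obtain ⟨hγv, hdv⟩ := mem_cone.1 hvγ
  suffices key : ∀ (n : ℕ) (w : Fin 3 → ℕ), (w a - v a) + (v a - w a) = n → w ∈ cone γ (t + 1) →
      w ∈ J from fun w hw => key _ w rfl hw
  intro n
  induction n with
  | zero =>
    intro w hn hw
    obtain ⟨hγw, hdw⟩ := mem_cone.1 hw
    by_cases hwb : γ b < w b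
    · exact hQ (mem_cone.2 ⟨add_unit_le_of_lt hγw hwb, by rw [deg_add_unit]; omega⟩)
    have hwb' : w b = γ b := le_antisymm (not_lt.1 hwb) (apply_le hγw b)
    rw [hdeg w, hdeg γ] at hdw
    rw [hdeg v, hdeg γ] at hdv
    have : w = v := by
      funext k
      rcases eq_or_eq_or_eq_of_distinct hab hac hbc k with rfl | rfl | rfl <;> omega
    rwa [this]
  | succ n ih =>
    intro w hn hw
    obtain ⟨hγw, hdw⟩ := mem_cone.1 hw
    by_cases hwb : γ b < w b
    · exact hQ (mem_cone.2 ⟨add_unit_le_of_lt hγw hwb, by rw [deg_add_unit]; omega⟩)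
    have hwb' : w b = γ b := le_antisymm (not_lt.1 hwb) (apply_le hγw b)
    have hdw' := hdw
    rw [hdeg w, hdeg γ] at hdw'
    rw [hdeg v, hdeg γ] at hdv
    have move : ∀ (x y : Fin 3) (ν : Fin 3 → ℕ), x ≠ b → x ≠ y → b ≠ y → ν + unit x = w →
        γ x < w x → ν + unit y ∈ J → w ∈ J := by
      rintro x y ν hxb hxy hby rfl hx hy
      have hγν : γ ≤ ν := le_of_le_add_unit hγw (by rw [add_unit_same] at hx; omega)
      refine hJ ν b y x hby hxb.symm hxy.symm (hQ (mem_cone.2 ⟨?_, ?_⟩)) hy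
      · exact add_le_add_left hγν (unit b)
      · rw [deg_add_unit] at hdw
        rw [deg_add_unit, deg_add_unit]
        omega
    have hva := apply_le hγv a
    have hvc := apply_le hγv c
    rcases lt_or_ge (v a) (w a) with hlt | hge
    · obtain ⟨ν, rfl⟩ := exists_add_unit_eq (show 1 ≤ w a by omega)
      have h1 := add_unit_same ν a
      have h2 := add_unit_same ν c
      have h3 := add_unit_ne ν hac
      have h4 := add_unit_ne ν hac.symm
      refine move a c ν hab hac hbc rfl (by omega) (ih (ν + unit c) ?_ (mem_cone.2 ⟨?_, ?_⟩))
      · omega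
      · exact (le_of_le_add_unit hγw (by omega)).trans (le_add_unit ν c)
      · rw [deg_add_unit] at hdw ⊢; exact hdw
    · obtain ⟨ν, rfl⟩ := exists_add_unit_eq (show 1 ≤ w c by omega)
      have h1 := add_unit_same ν c
      have h2 := add_unit_same ν a
      have h3 := add_unit_ne ν hac
      have h4 := add_unit_ne ν hac.symm
      refine move c a ν hbc.symm hac.symm hab.symm rfl (by omega)
        (ih (ν + unit a) ?_ (mem_cone.2 ⟨?_, ?_⟩))
      · omega
      · exact (le_of_le_add_unit hγw (by omega)).trans (le_add_unit ν a)
      · rw [deg_add_unit] at hdw ⊢; exact hdw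

/-- Start from the cone formed by one point. While the cone is not all of `J`, connectedness
supplies a point of `J` next to one of its sides, and `TriangleClosed.cone_subset` enlarges the cone
across that side. The degree of the apex `γ` drops each time, so this stops. -/
theorem TriangleClosed.eq_cone {J : Finset (Fin 3 → ℕ)} (hJ : TriangleClosed J) {d : ℕ}
    (hd : ∀ u ∈ J, deg u = d) (hc : ShadowConnected J) (hne : J.Nonempty) :
    ∃ γ t, deg γ + t = d ∧ J = cone γ t := by
  have key : ∀ n, ∀ γ : Fin 3 → ℕ, deg γ = n → ∀ t, n + t = d → cone γ t ⊆ J →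
      ∃ γ t, deg γ + t = d ∧ J = cone γ t := by
    intro n
    induction n with
    | zero =>
      intro γ hγ t ht hs
      refine ⟨γ, t, by omega, Finset.Subset.antisymm (fun u hu => mem_cone.2 ⟨fun k => ?_, ?_⟩) hs⟩
      · have : γ k ≤ deg γ := Finset.single_le_sum (fun _ _ => Nat.zero_le _) (Finset.mem_univ k)
        show γ k ≤ u k
        omega
      · rw [hd u hu]; omega
    | succ n ih =>
      intro γ hγ t ht hs
      by_cases hsub : J ⊆ cone γ t
      · exact ⟨γ, t, by omega, Finset.Subset.antisymm hsub hs⟩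
      obtain ⟨w, hw, hw'⟩ := Finset.not_subset.1 hsub
      have hcone : (cone γ t).Nonempty := by
        rw [← Finset.card_pos, card_cone]
        have := card_antidiagonalTuple_three t
        nlinarith
      have := hc (cone γ t) (J \ cone γ t) hcone ⟨w, Finset.mem_sdiff.2 ⟨hw, hw'⟩⟩
        (Finset.union_sdiff_of_subset hs)
      obtain ⟨x, hx1, hx2⟩ := Finset.not_disjoint_iff.1 this
      obtain ⟨u, hu, i, rfl⟩ := mem_shadow.1 hx1
      obtain ⟨v, hv, j, hvu⟩ := mem_shadow.1 hx2
      obtain ⟨hvJ, hvc⟩ := Finset.mem_sdiff.1 hv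
      obtain ⟨hγu, -⟩ := mem_cone.1 hu
      have hnle : ¬ γ ≤ v := fun h => hvc (mem_cone.2 ⟨h, by rw [hd v hvJ]; omega⟩)
      rw [Pi.le_def] at hnle
      push Not at hnle
      obtain ⟨b, hb⟩ := hnle
      replace hb : v b < γ b := hb
      have hbu := apply_le hγu b
      have hjb : j = b := by
        by_contra hne
        have := congrFun hvu b
        rw [add_unit_ne v (Ne.symm hne)] at this
        have := apply_le (le_add_unit u i) b
        omega
      subst hjb
      have hij : j ≠ i := by
        rintro rfl
        have := congrFun hvu j
        rw [add_unit_same, add_unit_same] at this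
        omega
      have hvj := congrFun hvu j
      rw [add_unit_same, add_unit_ne _ hij] at hvj
      obtain ⟨γ', rfl⟩ := exists_add_unit_eq (show 1 ≤ γ j by omega)
      rw [deg_add_unit] at hγ
      rw [add_unit_same] at hb hbu
      have hγ'v : γ' ≤ v := by
        refine le_of_le_add_unit (k := j) ?_ (by omega)
        rw [hvu]
        exact (le_add_unit γ' j).trans (hγu.trans (le_add_unit u i))
      exact ih γ' (by omega) (t + 1) (by omega) (hJ.cone_subset hs hvJ
        (mem_cone.2 ⟨hγ'v, by rw [hd v hvJ]; omega⟩) (le_antisymm (by omega) (apply_le hγ'v j)))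
  obtain ⟨u, hu⟩ := hne
  refine key d u (hd u hu) 0 rfl fun v hv => ?_
  obtain ⟨h1, h2⟩ := mem_cone.1 hv
  rwa [← eq_of_le_of_deg_le h1 (by omega)]

end ThreeVariables
-- The isoperimetric inequality in three variables.
section ThreeVariables

/-- Adding to `J` the third vertex of a triangle does not increase the surplus
`#(shadow J) - #J`. -/
theorem shadow_insert_subset {J : Finset (Fin 3 → ℕ)} {ν : Fin 3 → ℕ} {a b c : Fin 3}
    (hab : a ≠ b) (hac : a ≠ c) (hbc : b ≠ c) (ha : ν + unit a ∈ J) (hb : ν + unit b ∈ J) :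
    shadow (insert (ν + unit c) J) = insert (ν + unit c + unit c) (shadow J) := by
  ext x
  rw [mem_shadow, Finset.mem_insert, mem_shadow]
  constructor
  · rintro ⟨u, hu, k, rfl⟩
    rcases Finset.mem_insert.1 hu with rfl | hu
    · rcases eq_or_eq_or_eq_of_distinct hab hac hbc k with rfl | rfl | rfl
      · exact Or.inr ⟨_, ha, c, add_right_comm _ _ _⟩
      · exact Or.inr ⟨_, hb, c, add_right_comm _ _ _⟩
      · exact Or.inl rfl
    · exact Or.inr ⟨u, hu, k, rfl⟩
  · rintro (rfl | ⟨u, hu, k, rfl⟩)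
    · exact ⟨_, Finset.mem_insert_self _ _, c, rfl⟩
    · exact ⟨u, Finset.mem_insert_of_mem hu, k, rfl⟩

/-- A multiple of `ν + 𝐜` that exceeds `ν` in direction `a` or `b` is already a multiple of `ν + 𝐚`
or `ν + 𝐛`. -/
theorem mem_up_insert {J : Finset (Fin 3 → ℕ)} {ν : Fin 3 → ℕ} {a b c : Fin 3}
    (hab : a ≠ b) (hac : a ≠ c) (hbc : b ≠ c) (ha : ν + unit a ∈ J) (hb : ν + unit b ∈ J)
    {x : Fin 3 → ℕ} (hx : x ∈ up (↑(insert (ν + unit c) J) : Set (Fin 3 → ℕ))) :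
    x ∈ up (J : Set (Fin 3 → ℕ)) ∨ ∃ s : ℕ, x = ν + unit c + s • unit c := by
  obtain ⟨β, hβ, hle⟩ := hx
  rw [Finset.mem_coe, Finset.mem_insert] at hβ
  rcases hβ with rfl | hβ
  · have hν : ν ≤ x := (le_add_unit ν c).trans hle
    by_cases h1 : ν a < x a
    · exact Or.inl ⟨_, ha, add_unit_le_of_lt hν h1⟩
    by_cases h2 : ν b < x b
    · exact Or.inl ⟨_, hb, add_unit_le_of_lt hν h2⟩
    refine Or.inr ⟨x c - (ν c + 1), ?_⟩
    have h3 := apply_le hν a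
    have h4 := apply_le hν b
    have h5 := apply_le hle c
    rw [add_unit_same] at h5
    funext k
    rcases eq_or_eq_or_eq_of_distinct hab hac hbc k with rfl | rfl | rfl
    · simp [unit, hac]; omega
    · simp [unit, hbc]; omega
    · simp [unit]; omega
  · exact Or.inl ⟨β, hβ, hle⟩

/-- If the third vertex `v = ν + 𝐜` of a triangle is added to `J`, with `v + 𝐜` not in the shadow of
`J`, then the ideal grows only by the multiples `v + s𝐜`. -/
theorem notMem_up_of_noIsolated_insert {d : ℕ} {J : Finset (Fin 3 → ℕ)} (hd : ∀ u ∈ J, deg u = d)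
    {ν : Fin 3 → ℕ} {a b c : Fin 3} (hab : a ≠ b) (hac : a ≠ c) (hbc : b ≠ c)
    (ha : ν + unit a ∈ J) (hb : ν + unit b ∈ J)
    (hc : ν + unit c ∉ J) (hcc : ν + unit c + unit c ∉ shadow J)
    (hI : NoIsolated (d + 1) (up (↑(insert (ν + unit c) J) : Set (Fin 3 → ℕ)))) (s : ℕ) :
    ν + unit c + s • unit c ∉ up (J : Set (Fin 3 → ℕ)) := by
  have hdv : deg (ν + unit c) = d := by rw [← hd _ ha, deg_add_unit, deg_add_unit]
  have hdeg : ∀ s : ℕ, deg (ν + unit c + s • unit c) = d + s := by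
    intro s
    induction s with
    | zero => simpa using hdv
    | succ s ih => rw [succ_nsmul, ← add_assoc, deg_add_unit, ih]; ring
  induction s with
  | zero =>
    intro h
    rw [zero_smul, add_zero] at h
    exact hc (mem_of_mem_up hd h hdv)
  | succ s ih =>
    intro h
    obtain ⟨k, θ, hθ, he⟩ := exists_pred_mem_up hd h (by rw [hdeg]; omega)
    rw [succ_nsmul, ← add_assoc] at he
    by_cases hkc : k = c
    · subst hkc
      exact ih (add_right_cancel he ▸ hθ)
    have hdθ : deg θ = d + s := by
      have := congrArg deg he
      rw [deg_add_unit, deg_add_unit, hdeg] at this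
      omega
    rcases Nat.eq_zero_or_pos s with rfl | hs
    · rw [zero_smul, add_zero] at he
      exact hcc (mem_shadow.2 ⟨θ, mem_of_mem_up hd hθ hdθ, k, he⟩)
    have hsub := up_mono (Finset.coe_subset.2 (Finset.subset_insert (ν + unit c) J))
    obtain ⟨l, hl, θ', hθ', he'⟩ := hI (ν + unit c + s • unit c)
      (mem_up_of_le (subset_up _ (Finset.mem_coe.2 (Finset.mem_insert_self _ _))) le_self_add)
      θ (hsub hθ) c k (Ne.symm hkc) he.symm (by rw [hdeg]; omega)
    rcases mem_up_insert hab hac hbc ha hb hθ' with h' | ⟨s', rfl⟩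
    · exact ih (he' ▸ mem_up_of_le h' (le_add_unit θ' l))
    · have := congrFun he' l
      simp [unit, hl] at this

/-- A witness in the larger ideal fails for `J` only if it is some `ν + 𝐜 + s𝐜`. Then `β` is known
explicitly: either direction `c` can be removed instead, or the larger ideal is consulted at `β'`
with the roles of `i` and `j` exchanged. -/
theorem noIsolated_of_noIsolated_insert {d : ℕ} {J : Finset (Fin 3 → ℕ)}
    (hd : ∀ u ∈ J, deg u = d)
    {ν : Fin 3 → ℕ} {a b c : Fin 3} (hab : a ≠ b) (hac : a ≠ c) (hbc : b ≠ c)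
    (ha : ν + unit a ∈ J) (hb : ν + unit b ∈ J)
    (hc : ν + unit c ∉ J) (hcc : ν + unit c + unit c ∉ shadow J)
    (hI : NoIsolated (d + 1) (up (↑(insert (ν + unit c) J) : Set (Fin 3 → ℕ)))) :
    NoIsolated (d + 1) (up (J : Set (Fin 3 → ℕ))) := by
  have hnot := notMem_up_of_noIsolated_insert hd hab hac hbc ha hb hc hcc hI
  have hsub := up_mono (Finset.coe_subset.2 (Finset.subset_insert (ν + unit c) J))
  have hmem := fun {x} => mem_up_insert hab hac hbc ha hb (x := x)
  -- `x` and `y` are the two directions other than `c`, in either order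
  have aux : ∀ x y : Fin 3, x ≠ y → x ≠ c → y ≠ c → ν + unit x ∈ J →
      ∀ (s : ℕ) (i j : Fin 3), i ≠ j → x ≠ i →
      ν + unit c + s • unit c + unit x ∈ up (J : Set (Fin 3 → ℕ)) →
      ∀ β' ∈ up (J : Set (Fin 3 → ℕ)), ν + unit c + s • unit c + unit x + unit i = β' + unit j →
      d + 1 ≤ deg (ν + unit c + s • unit c + unit x) →
      ∃ l, l ≠ i ∧ ∃ θ ∈ up (J : Set (Fin 3 → ℕ)), θ + unit l = ν + unit c + s • unit c + unit x := by
    intro x y hxy hxc hyc hx s i j hij hxi hβ β' hβ' he hdeg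
    rcases eq_or_eq_or_eq_of_distinct hxy hxc hyc i with rfl | rfl | rfl
    · exact absurd rfl hxi
    · refine ⟨c, hyc.symm, ν + unit x + s • unit c, mem_up_of_le (subset_up _ hx) le_self_add, ?_⟩
      abel
    · rcases eq_or_eq_or_eq_of_distinct hxy hxc hyc j with rfl | rfl | rfl
      · exfalso
        have : β' = ν + unit i + (s + 1) • unit i := by
          refine add_right_cancel (he.symm.trans ?_)
          rw [succ_nsmul]; abel
        exact hnot (s + 1) (this ▸ hβ')
      · have hd' : d + 1 ≤ deg β' := by
          have := congrArg deg he
          rw [deg_add_unit, deg_add_unit β'] at this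
          omega
        obtain ⟨l, hl, θ, hθ, rfl⟩ := hI β' (hsub hβ') _ (hsub hβ) j i hyc he.symm hd'
        rcases eq_or_eq_or_eq_of_distinct hxy hxc hyc l with rfl | rfl | rfl
        · exfalso
          have h1 : θ + unit j = ν + unit i + (s + 1) • unit i := by
            refine add_right_cancel (b := unit l) ?_
            rw [add_right_comm θ, ← he, succ_nsmul]; abel
          rcases hmem hθ with h | ⟨s', rfl⟩
          · exact hnot (s + 1) (h1 ▸ mem_up_of_le h (le_add_unit θ j))
          · have := congrFun h1 j
            simp [unit, hyc] at this
        · exact absurd rfl hl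
        · have h1 : θ + unit j = ν + unit l + s • unit l + unit x := by
            refine add_right_cancel (b := unit l) ?_
            rw [add_right_comm θ, ← he]
          rcases hmem hθ with h | ⟨s', rfl⟩
          · exact ⟨j, hyc, θ, h, h1⟩
          · have := congrFun h1 j
            simp [unit, hyc, hxy.symm] at this
      · exact absurd rfl hij
  intro β hβ β' hβ' i j hij he hdeg
  obtain ⟨l, hl, θ, hθ, rfl⟩ := hI β (hsub hβ) β' (hsub hβ') i j hij he hdeg
  rcases hmem hθ with h | ⟨s, rfl⟩
  · exact ⟨l, hl, θ, h, rfl⟩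
  rcases eq_or_eq_or_eq_of_distinct hab hac hbc l with rfl | rfl | rfl
  · exact aux l b hab hac hbc ha s i j hij hl hβ β' hβ' he hdeg
  · exact aux l a hab.symm hbc hac hb s i j hij hl hβ β' hβ' he hdeg
  · refine absurd hβ ?_
    rw [add_assoc, ← succ_nsmul]
    exact hnot (s + 1)

/-- A connected set of monomials of degree `deg γ + t`, with greatest common divisor `γ`, has at
least `t + 2` more multiples in the next degree than elements; in the case of equality there are no
isolated directions. -/
theorem card_shadow_of_shadowConnected {γ : Fin 3 → ℕ} {t : ℕ} :
    ∀ (n : ℕ) {J : Finset (Fin 3 → ℕ)}, (cone γ t \ J).card = n → J ⊆ cone γ t →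
      (∀ k, ∃ u ∈ J, u k = γ k) → ShadowConnected J →
      J.card + t + 2 ≤ (shadow J).card ∧ ((shadow J).card = J.card + t + 2 →
        NoIsolated (deg γ + t + 1) (up (J : Set (Fin 3 → ℕ)))) := by
  intro n
  induction n with
  | zero =>
    intro J hn hJ _ _
    have hJ' : J = cone γ t := by
      refine Finset.Subset.antisymm hJ (Finset.sdiff_eq_empty_iff_subset.1 (Finset.card_eq_zero.1 hn))
    subst hJ'
    refine ⟨?_, fun _ => noIsolated_up_cone γ t⟩
    rw [shadow_cone, card_cone, card_cone]
    have h1 := card_antidiagonalTuple_three t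
    have h2 := card_antidiagonalTuple_three (t + 1)
    nlinarith
  | succ n ih =>
    intro J hn hJ hγ hc
    have hd : ∀ u ∈ J, deg u = deg γ + t := fun u hu => (mem_cone.1 (hJ hu)).2
    by_cases hcl : TriangleClosed J
    · exfalso
      obtain ⟨u, hu, -⟩ := hγ 0
      obtain ⟨γ', t', ht, rfl⟩ := hcl.eq_cone hd hc ⟨u, hu⟩
      have hle : γ' ≤ γ := by
        intro k
        obtain ⟨u, hu, hk⟩ := hγ k
        rw [← hk]
        exact (mem_cone.1 hu).1 k
      have : cone γ t \ cone γ' t' = ∅ := by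
        refine Finset.sdiff_eq_empty_iff_subset.2 fun x hx => ?_
        obtain ⟨h1, h2⟩ := mem_cone.1 hx
        exact mem_cone.2 ⟨hle.trans h1, by omega⟩
      rw [this] at hn
      simp at hn
    unfold TriangleClosed at hcl
    push Not at hcl
    obtain ⟨ν, a, b, c, hab, hac, hbc, ha, hb, hcJ⟩ := hcl
    have hγν : γ ≤ ν := by
      intro k
      by_cases hk : k = a
      · subst hk
        have := apply_le (mem_cone.1 (hJ hb)).1 k
        rwa [add_unit_ne _ hab] at this
      · have := apply_le (mem_cone.1 (hJ ha)).1 k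
        rwa [add_unit_ne _ hk] at this
    have hv : ν + unit c ∈ cone γ t := by
      refine mem_cone.2 ⟨hγν.trans (le_add_unit ν c), ?_⟩
      rw [← hd _ ha, deg_add_unit, deg_add_unit]
    obtain ⟨h1, h2⟩ := ih (J := insert (ν + unit c) J)
      (by
        rw [Finset.sdiff_insert, Finset.card_erase_of_mem, hn]
        · rfl
        · exact Finset.mem_sdiff.2 ⟨hv, hcJ⟩)
      (Finset.insert_subset hv hJ)
      (fun k => (hγ k).imp fun u hu => ⟨Finset.mem_insert_of_mem hu.1, hu.2⟩)
      (shadowConnected_insert hc ha (add_right_comm ν (unit a) (unit c)))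
    rw [shadow_insert_subset hab hac hbc ha hb, Finset.card_insert_of_notMem hcJ] at h1 h2
    -- If the shadow does not grow, the insertion lowers the surplus strictly, so equality cannot
    -- hold for `J`.
    by_cases hcc : ν + unit c + unit c ∈ shadow J
    · rw [Finset.insert_eq_of_mem hcc] at h1
      exact ⟨by omega, fun h => by omega⟩
    · rw [Finset.card_insert_of_notMem hcc] at h1 h2
      exact ⟨by omega, fun h =>
        noIsolated_of_noIsolated_insert hd hab hac hbc ha hb hcJ hcc (h2 (by omega))⟩

/-- An isoperimetric inequality for sets of monomials in three variables. -/
theorem card_le_of_card_shadow {d : ℕ} :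
    ∀ (J : Finset (Fin 3 → ℕ)), J.Nonempty → (∀ u ∈ J, deg u = d) →
      ∃ n, (shadow J).card = J.card + n + 2 ∧ 2 * J.card ≤ (n + 1) * (n + 2) ∧
        (¬ NoIsolated (d + 1) (up (J : Set (Fin 3 → ℕ))) → 2 * J.card ≤ n * (n + 1)) := by
  intro J
  induction hn : J.card using Nat.strong_induction_on generalizing J with
  | _ N ih =>
    intro hne hd
    subst hn
    by_cases hc : ShadowConnected J
    · let γ : Fin 3 → ℕ := fun k => J.inf' hne fun u => u k
      have hγ : ∀ u ∈ J, γ ≤ u := fun u hu k => Finset.inf'_le _ hu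
      have hγ' : ∀ k, ∃ u ∈ J, u k = γ k := by
        intro k
        obtain ⟨u, hu, h⟩ := Finset.exists_mem_eq_inf' hne fun u : Fin 3 → ℕ => u k
        exact ⟨u, hu, h.symm⟩
      obtain ⟨u, hu⟩ := hne
      have hdγ : deg γ ≤ d := hd u hu ▸ deg_mono (hγ u hu)
      obtain ⟨t, rfl⟩ := Nat.exists_eq_add_of_le hdγ
      have hJ : J ⊆ cone γ t := fun u hu => mem_cone.2 ⟨hγ u hu, hd u hu⟩
      obtain ⟨h1, h2⟩ := card_shadow_of_shadowConnected _ rfl hJ hγ' hc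
      have h3 := Finset.card_le_card hJ
      rw [card_cone] at h3
      have h4 := card_antidiagonalTuple_three t
      refine ⟨(shadow J).card - J.card - 2, by omega, ?_, fun h => ?_⟩
      · obtain ⟨e, he⟩ := Nat.exists_eq_add_of_le h1
        have : (shadow J).card - J.card - 2 = t + e := by omega
        rw [this]
        nlinarith
      · have h5 : (shadow J).card ≠ J.card + t + 2 := fun he => h (h2 he)
        obtain ⟨e, he⟩ := Nat.exists_eq_add_of_le h1
        obtain ⟨f, rfl⟩ : ∃ f, e = f + 1 := ⟨e - 1, by omega⟩
        have : (shadow J).card - J.card - 2 = t + (f + 1) := by omega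
        rw [this]
        nlinarith
    · unfold ShadowConnected at hc
      push Not at hc
      obtain ⟨A, B, hA, hB, rfl, hdis⟩ := hc
      have hAB : Disjoint A B := by
        rw [Finset.disjoint_left]
        intro x h1 h2
        exact (Finset.disjoint_left.1 hdis) (add_unit_mem_shadow h1 0) (add_unit_mem_shadow h2 0)
      have hcard := Finset.card_union_of_disjoint hAB
      have hA0 := hA.card_pos
      have hB0 := hB.card_pos
      obtain ⟨x, hx1, hx2, -⟩ := ih A.card (by omega) A rfl hA
        fun u hu => hd u (Finset.mem_union_left B hu)
      obtain ⟨y, hy1, hy2, -⟩ := ih B.card (by omega) B rfl hB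
        fun u hu => hd u (Finset.mem_union_right A hu)
      -- The surpluses of the two pieces add up: `(x + 2) + (y + 2) = (x + y + 2) + 2`. This is
      -- wasteful enough to give even the sharper bound.
      refine ⟨x + y + 2, ?_, ?_, fun _ => ?_⟩
      · rw [shadow_union, Finset.card_union_of_disjoint hdis]; omega
      · rw [hcard]; nlinarith
      · rw [hcard]; nlinarith

end ThreeVariables
-- Layers of truncated monomial ideals.
section Layers

variable {m : ℕ}

/-- The monomial ideal generated by the elements of `G` of degree at most `p`. -/
def truncIdeal (G : Set (Fin m → ℕ)) (p : ℕ) : Set (Fin m → ℕ) := up {β | β ∈ G ∧ deg β ≤ p}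

theorem truncIdeal_mono (G : Set (Fin m → ℕ)) {p q : ℕ} (h : p ≤ q) :
    truncIdeal G p ⊆ truncIdeal G q :=
  up_mono fun _ hβ => ⟨hβ.1, hβ.2.trans h⟩

open Classical in
/-- The monomials of degree `p` in `truncIdeal G p`. -/
noncomputable def layer (G : Set (Fin m → ℕ)) (p : ℕ) : Finset (Fin m → ℕ) :=
  (cone 0 p).filter (· ∈ truncIdeal G p)

theorem deg_zero : deg (0 : Fin m → ℕ) = 0 := by simp [deg]

theorem mem_layer {G : Set (Fin m → ℕ)} {p : ℕ} {τ : Fin m → ℕ} :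
    τ ∈ layer G p ↔ deg τ = p ∧ τ ∈ truncIdeal G p := by
  simp only [layer, Finset.mem_filter, mem_cone, deg_zero, zero_add]
  exact ⟨fun h => ⟨h.1.2, h.2⟩, fun h => ⟨⟨fun _ => Nat.zero_le _, h.1⟩, h.2⟩⟩

theorem deg_of_mem_layer {G : Set (Fin m → ℕ)} {p : ℕ} : ∀ u ∈ layer G p, deg u = p :=
  fun _ h => (mem_layer.1 h).1

theorem card_layer_le (G : Set (Fin m → ℕ)) (p : ℕ) :
    (layer G p).card ≤ (Finset.Nat.antidiagonalTuple m p).card := by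
  classical
  rw [← card_cone 0 p]
  exact Finset.card_le_card (Finset.filter_subset _ _)

theorem mem_truncIdeal_iff {G : Set (Fin m → ℕ)} {p : ℕ} {τ : Fin m → ℕ} (h : p ≤ deg τ) :
    τ ∈ truncIdeal G p ↔ τ ∈ up (layer G p : Set (Fin m → ℕ)) := by
  constructor
  · rintro ⟨β, hβ, hle⟩
    obtain ⟨μ, h1, h2, h3⟩ := exists_between hle hβ.2 h
    exact ⟨μ, mem_layer.2 ⟨h3, ⟨β, hβ, h1⟩⟩, h2⟩
  · rintro ⟨μ, hμ, hle⟩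
    exact mem_up_of_le (mem_layer.1 hμ).2 hle

theorem shadow_layer_subset (G : Set (Fin m → ℕ)) (p : ℕ) :
    shadow (layer G p) ⊆ layer G (p + 1) := by
  intro x hx
  obtain ⟨u, hu, k, rfl⟩ := mem_shadow.1 hx
  obtain ⟨h1, h2⟩ := mem_layer.1 hu
  exact mem_layer.2 ⟨by rw [deg_add_unit, h1],
    mem_up_of_le (truncIdeal_mono G (Nat.le_succ p) h2) (le_add_unit u k)⟩

/-- Without new generators in degree `p + 1`, the ideal does not change in degrees from `p` on. -/
theorem mem_truncIdeal_succ_iff {G : Set (Fin m → ℕ)} {p : ℕ}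
    (h : layer G (p + 1) = shadow (layer G p)) {τ : Fin m → ℕ} (hτ : p ≤ deg τ) :
    τ ∈ truncIdeal G (p + 1) ↔ τ ∈ up (layer G p : Set (Fin m → ℕ)) := by
  rw [← mem_truncIdeal_iff hτ]
  constructor
  · intro ⟨β, hβ, hle⟩
    rcases Nat.lt_or_ge p (deg β) with hlt | hge
    · have hβ' : β ∈ layer G (p + 1) :=
        mem_layer.2 ⟨le_antisymm hβ.2 hlt, subset_up _ hβ⟩
      rw [h] at hβ'
      obtain ⟨u, hu, k, rfl⟩ := mem_shadow.1 hβ'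
      exact mem_up_of_le (mem_layer.1 hu).2 ((le_add_unit u k).trans hle)
    · exact ⟨β, ⟨hβ.1, hge⟩, hle⟩
  · exact fun hτ => truncIdeal_mono G (Nat.le_succ p) hτ

/-- The first degree in which there is an isolated direction contains at least two elements. -/
theorem two_le_card_layer {G : Set (Fin m → ℕ)} {p : ℕ} (h : ¬ NoIsolated p (truncIdeal G p)) :
    2 ≤ (layer G p).card := by
  by_contra! hlt
  refine h ?_
  rcases Nat.lt_or_ge (layer G p).card 1 with h0 | h1
  · intro β hβ _ _ _ _ _ _ hd
    obtain ⟨μ, hμ, -⟩ := (mem_truncIdeal_iff hd).1 hβ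
    have : layer G p = ∅ := Finset.card_eq_zero.1 (by omega)
    rw [this] at hμ
    simp at hμ
  · obtain ⟨μ, hμ⟩ := Finset.card_eq_one.1 (show (layer G p).card = 1 by omega)
    have hmem : μ ∈ layer G p := by rw [hμ]; exact Finset.mem_singleton_self μ
    refine noIsolated_of_forall_le μ (fun τ hτ hd => ?_)
      fun τ hle _ => mem_up_of_le (mem_layer.1 hmem).2 hle
    obtain ⟨β, hβ, hle⟩ := (mem_truncIdeal_iff hd).1 hτ
    rw [hμ, Finset.coe_singleton, Set.mem_singleton_iff] at hβ
    exact hβ ▸ hle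

end Layers

/-! ### Growth of layers and the upper bound in three variables. -/

section ThreeVariables

variable {G : Set (Fin 3 → ℕ)}

/-- Either a new generator in degree `p + 1` adds a point to the shadow, or the ideal is unchanged
and its isolated direction sharpens the isoperimetric inequality. -/
theorem card_layer_succ {p M : ℕ} (h : ¬ NoIsolated (p + 1) (truncIdeal G (p + 1)))
    (hM : M * (M + 1) < 2 * (layer G p).card) :
    (layer G p).card + M + 3 ≤ (layer G (p + 1)).card := by
  have hne : (layer G p).Nonempty := Finset.card_pos.1 (by omega)
  obtain ⟨n, h1, h2, h3⟩ := card_le_of_card_shadow (layer G p) hne deg_of_mem_layer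
  by_cases he : layer G (p + 1) = shadow (layer G p)
  · have h4 := h3 fun hn => h (hn.congr fun τ hτ => (mem_truncIdeal_succ_iff he hτ).symm)
    have h5 : M < n := by
      by_contra! hle
      have := Nat.mul_le_mul hle (Nat.add_le_add_right hle 1)
      omega
    rw [he]
    omega
  · have h4 : (shadow (layer G p)).card < (layer G (p + 1)).card :=
      Finset.card_lt_card ((shadow_layer_subset G p).ssubset_of_ne (Ne.symm he))
    have h5 : M < n + 1 := by
      by_contra! hle
      have := Nat.mul_le_mul hle (show n + 2 ≤ M + 1 by omega)
      omega
    omega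

/-- In degree `u + c` the layer is compared with a full triangle of side `u`, with deficit at most
`b`. A bad level adds `u + 3` points and the triangle of side `u + 1` only `u + 2`, so `b` drops by
one. With `b = 0` the comparison passes to side `u + 2` with deficit `u + 2`, and `c` drops; since
`(u + 2) + (u + 2) + 4 = 2 (u + 4)`, the bound keeps its form. -/
theorem exists_noIsolated_of_card_layer : ∀ c b u : ℕ, b ≤ u →
    (u + 1) * (u + 2) ≤ 2 * (layer G (u + c)).card + 2 * b →
      ∃ p, u + c < p ∧ p + 3 ≤ 2 ^ c * (u + b + 4) ∧ NoIsolated p (truncIdeal G p) := by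
  intro c
  induction c with
  | zero =>
    intro b
    induction b with
    | zero =>
      intro u _ hu
      refine ⟨u + 1, by omega, by omega, ?_⟩
      by_contra hg
      -- The layer contains all monomials of degree `u`; a bad level would need more than all those
      -- of degree `u + 1`.
      have h1 := card_layer_succ hg (M := u) (by rw [add_zero] at hu; nlinarith)
      have h2 := card_layer_le G (u + 1)
      have h3 := card_antidiagonalTuple_three (u + 1)
      rw [add_zero] at hu
      nlinarith
    | succ b ih =>
      intro u hb hu
      simp only [add_zero] at hu ih ⊢
      by_cases hg : NoIsolated (u + 1) (truncIdeal G (u + 1))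
      · exact ⟨u + 1, by omega, by omega, hg⟩
      have h1 := card_layer_succ hg (M := u) (by nlinarith)
      obtain ⟨p, hp1, hp2, hp3⟩ := ih (u + 1) (by omega) (by
        nlinarith)
      exact ⟨p, by omega, by rw [show u + (b + 1) + 4 = u + 1 + b + 4 by ring]; exact hp2, hp3⟩
  | succ c ihc =>
    intro b
    induction b with
    | zero =>
      intro u _ hu
      by_cases hg : NoIsolated (u + (c + 1) + 1) (truncIdeal G (u + (c + 1) + 1))
      · refine ⟨_, by omega, ?_, hg⟩
        have := Nat.lt_two_pow_self (n := c + 1)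
        nlinarith
      have h1 := card_layer_succ hg (M := u) (by nlinarith)
      obtain ⟨p, hp1, hp2, hp3⟩ := ihc (u + 2) (u + 2) le_rfl (by
        rw [show u + 2 + c = u + (c + 1) + 1 by ring]
        nlinarith)
      refine ⟨p, by omega, hp2.trans (le_of_eq ?_), hp3⟩
      ring
    | succ b ih =>
      intro u hb hu
      by_cases hg : NoIsolated (u + (c + 1) + 1) (truncIdeal G (u + (c + 1) + 1))
      · refine ⟨_, by omega, ?_, hg⟩
        have := Nat.lt_two_pow_self (n := c + 1)
        nlinarith
      have h1 := card_layer_succ hg (M := u) (by nlinarith)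
      obtain ⟨p, hp1, hp2, hp3⟩ := ih (u + 1) (by omega) (by
        rw [show u + 1 + (c + 1) = u + (c + 1) + 1 by ring]
        nlinarith)
      exact ⟨p, by omega, by rw [show u + (b + 1) + 4 = u + 1 + b + 4 by ring]; exact hp2, hp3⟩

/-- In three variables, isolated directions disappear in some degree between `r` and
`3 (2 ^ r - 1)`. -/
theorem exists_noIsolated_three (G : Set (Fin 3 → ℕ)) (r : ℕ) :
    ∃ p, r ≤ p ∧ p ≤ 3 * (2 ^ r - 1) ∧ NoIsolated p (truncIdeal G p) := by
  by_cases hg : NoIsolated r (truncIdeal G r)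
  · have := Nat.lt_two_pow_self (n := r)
    exact ⟨r, le_rfl, by omega, hg⟩
  have h2 := two_le_card_layer hg
  cases r with
  | zero =>
    have h1 := card_layer_le G 0
    have h3 := card_antidiagonalTuple_three 0
    omega
  | succ r =>
    -- Two points are a triangle of side `1`, which has three points, with deficit `1`.
    obtain ⟨p, hp1, hp2, hp3⟩ := exists_noIsolated_of_card_layer (G := G) r 1 1 le_rfl (by
      rw [add_comm 1 r]
      omega)
    refine ⟨p, by omega, ?_, hp3⟩
    rw [pow_succ]
    have := Nat.one_le_two_pow (n := r)
    omega

end ThreeVariables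

/-! ### Growth of layers and the upper bound in two variables. -/

section TwoVariables

theorem card_lt_card_shadow {A : Finset (Fin 2 → ℕ)} (hA : A.Nonempty) :
    A.card < (shadow A).card := by
  obtain ⟨u, hu, hmin⟩ := A.exists_min_image (fun u => u 0) hA
  have h1 : A.image (· + unit 0) ⊆ shadow A := by
    intro x hx
    obtain ⟨v, hv, rfl⟩ := Finset.mem_image.1 hx
    exact add_unit_mem_shadow hv 0
  have h2 : u + unit 1 ∉ A.image (· + unit 0) := by
    intro h
    obtain ⟨v, hv, he⟩ := Finset.mem_image.1 h
    have h3 := congrFun he 0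
    rw [add_unit_same, add_unit_ne u (by decide)] at h3
    have := hmin v hv
    omega
  have h3 : insert (u + unit 1) (A.image (· + unit 0)) ⊆ shadow A :=
    Finset.insert_subset (add_unit_mem_shadow hu 1) h1
  have h4 := Finset.card_le_card h3
  rw [Finset.card_insert_of_notMem h2,
    Finset.card_image_of_injective _ (add_left_injective (unit 0))] at h4
  omega

theorem deg_eq_of_ne {i j : Fin 2} (hij : i ≠ j) (ξ : Fin 2 → ℕ) : deg ξ = ξ i + ξ j := by
  have : (Finset.univ : Finset (Fin 2)) = {i, j} := by
    ext k
    simp only [Finset.mem_univ, Finset.mem_insert, Finset.mem_singleton, true_iff]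
    omega
  rw [deg, this, Finset.sum_pair hij]

/-- An isolated direction yields `θ` outside the ideal with `θ + 𝐢` and `θ + 𝐣` inside. It splits
`J` into the points exceeding `θ` in direction `i` and those exceeding it in direction `j`. A common
point of their shadows would have degree at least `deg θ + 2 > d + 1`, so the shadows are disjoint
and each part gains at least one. -/
theorem card_add_two_le_card_shadow {d : ℕ} {J : Finset (Fin 2 → ℕ)} (hd : ∀ u ∈ J, deg u = d)
    (h : ¬ NoIsolated (d + 1) (up (J : Set (Fin 2 → ℕ)))) : J.card + 2 ≤ (shadow J).card := by
  unfold NoIsolated at h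
  push Not at h
  obtain ⟨β, hβ, β', hβ', i, j, hij, he, hdeg, hno⟩ := h
  have hj := apply_eq_of_add_unit_eq hij he
  obtain ⟨θ, rfl⟩ := exists_add_unit_eq (show 1 ≤ β j by omega)
  have hθ : θ ∉ up (J : Set (Fin 2 → ℕ)) := fun hm => hno j hij.symm θ hm rfl
  have hβ'θ : β' = θ + unit i := by
    refine add_right_cancel (b := unit j) ?_
    rw [← he, add_right_comm]
  subst hβ'θ
  rw [deg_add_unit] at hdeg
  have key : ∀ k, θ + unit k ∈ up (J : Set (Fin 2 → ℕ)) → (J.filter fun u => θ k < u k).Nonempty := by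
    rintro k ⟨u, hu, hle⟩
    refine ⟨u, Finset.mem_filter.2 ⟨hu, ?_⟩⟩
    by_contra! hlt
    exact hθ ⟨u, hu, le_of_le_add_unit hle hlt⟩
  have hA := card_lt_card_shadow (key i hβ')
  have hB := card_lt_card_shadow (key j hβ)
  have hJ : (J.filter fun u => θ i < u i) ∪ (J.filter fun u => θ j < u j) = J := by
    ext u
    simp only [Finset.mem_union, Finset.mem_filter, ← and_or_left, and_iff_left_iff_imp]
    intro hu
    by_contra! hlt
    refine hθ ⟨u, hu, fun k => ?_⟩
    rcases (show k = i ∨ k = j by omega) with rfl | rfl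
    · exact hlt.1
    · exact hlt.2
  have hdis : Disjoint (shadow (J.filter fun u => θ i < u i))
      (shadow (J.filter fun u => θ j < u j)) := by
    rw [Finset.disjoint_left]
    intro x hx hx'
    obtain ⟨u, hu, k, rfl⟩ := mem_shadow.1 hx
    obtain ⟨v, hv, l, hvu⟩ := mem_shadow.1 hx'
    rw [Finset.mem_filter] at hu hv
    have h1 := apply_le (le_add_unit u k) i
    have h2 := apply_le (le_add_unit v l) j
    rw [hvu] at h2
    have h3 := deg_add_unit u k
    rw [hd u hu.1] at h3
    rw [deg_eq_of_ne hij] at h3 hdeg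
    omega
  have hc := Finset.card_union_le (J.filter fun u => θ i < u i) (J.filter fun u => θ j < u j)
  rw [hJ] at hc
  have hs := Finset.card_union_of_disjoint hdis
  rw [← shadow_union, hJ] at hs
  omega

theorem card_layer_succ_two {G : Set (Fin 2 → ℕ)} {p : ℕ}
    (h : ¬ NoIsolated (p + 1) (truncIdeal G (p + 1))) (hne : (layer G p).Nonempty) :
    (layer G p).card + 2 ≤ (layer G (p + 1)).card := by
  by_cases he : layer G (p + 1) = shadow (layer G p)
  · rw [he]
    exact card_add_two_le_card_shadow deg_of_mem_layer
      fun hn => h (hn.congr fun τ hτ => (mem_truncIdeal_succ_iff he hτ).symm)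
  · have h4 : (shadow (layer G p)).card < (layer G (p + 1)).card :=
      Finset.card_lt_card ((shadow_layer_subset G p).ssubset_of_ne (Ne.symm he))
    have := card_lt_card_shadow hne
    omega

/-- In two variables, isolated directions disappear in some degree between `r` and `2 r`. -/
theorem exists_noIsolated_two (G : Set (Fin 2 → ℕ)) (r : ℕ) :
    ∃ p, r ≤ p ∧ p ≤ 2 * r ∧ NoIsolated p (truncIdeal G p) := by
  by_contra! h
  have key : ∀ q, q ≤ r → 2 + 2 * q ≤ (layer G (r + q)).card := by
    intro q
    induction q with
    | zero => exact fun _ => two_le_card_layer (h r le_rfl (by omega))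
    | succ q ih =>
      intro hq
      have h1 := ih (by omega)
      have h2 := card_layer_succ_two (h (r + q + 1) (by omega) (by omega))
        (Finset.card_pos.1 (by omega))
      rw [← add_assoc]
      omega
  have h1 := key r le_rfl
  have h2 := card_layer_le G (r + r)
  rw [card_antidiagonalTuple_two] at h2
  omega

end TwoVariables
-- From linked directions to chains of generators, and criteria for bounds on `C`.
section Chains

variable {m n : ℕ}

/-- For `τ` of degree above `p`, any two directions `i, j` with `τ - 𝐢` and `τ - 𝐣` in `I` are
linked, where `k` and `l` are linked by an edge if `τ - 𝐤 - 𝐥` lies in `I`. -/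
def DirConnected (p : ℕ) (I : Set (Fin m → ℕ)) : Prop :=
  ∀ β ∈ I, ∀ β' ∈ I, ∀ i j, i ≠ j → β + unit i = β' + unit j → p ≤ deg β →
    (∃ θ ∈ I, θ + unit j = β ∧ θ + unit i = β') ∨
      ∃ k, k ≠ i ∧ k ≠ j ∧ (∃ θ ∈ I, θ + unit k = β) ∧ ∃ θ ∈ I, θ + unit k = β'

theorem deg_eq_of_add_unit_eq {β β' : Fin m → ℕ} {i j : Fin m}
    (h : β + unit i = β' + unit j) : deg β = deg β' := by
  have := congrArg deg h
  rw [deg_add_unit, deg_add_unit] at this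
  omega

theorem add_unit_eq_of_add_unit_eq {θ β β' : Fin m → ℕ} {i j : Fin m}
    (he : β + unit i = β' + unit j) (h : θ + unit j = β) : θ + unit i = β' := by
  refine add_right_cancel (b := unit j) ?_
  rw [← he, ← h, add_right_comm]

theorem NoIsolated.dirConnected_two {p : ℕ} {I : Set (Fin 2 → ℕ)} (h : NoIsolated p I) :
    DirConnected p I := by
  intro β hβ β' hβ' i j hij he hd
  obtain ⟨l, hl, θ, hθ, hθβ⟩ := h β hβ β' hβ' i j hij he hd
  obtain rfl : l = j := by omega
  exact Or.inl ⟨θ, hθ, hθβ, add_unit_eq_of_add_unit_eq he hθβ⟩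

/-- Apply the hypothesis at `β` and at `β'`. If neither answer links `i` with `j` directly, both
must be the one remaining direction. -/
theorem NoIsolated.dirConnected_three {p : ℕ} {I : Set (Fin 3 → ℕ)} (h : NoIsolated p I) :
    DirConnected p I := by
  intro β hβ β' hβ' i j hij he hd
  obtain ⟨l, hl, θ, hθ, hθβ⟩ := h β hβ β' hβ' i j hij he hd
  obtain ⟨l', hl', θ', hθ', hθβ'⟩ := h β' hβ' β hβ j i hij.symm he.symm
    (deg_eq_of_add_unit_eq he ▸ hd)
  by_cases h1 : l = j
  · subst h1
    exact Or.inl ⟨θ, hθ, hθβ, add_unit_eq_of_add_unit_eq he hθβ⟩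
  by_cases h2 : l' = i
  · subst h2
    exact Or.inl ⟨θ', hθ', add_unit_eq_of_add_unit_eq he.symm hθβ', hθβ'⟩
  obtain rfl : l = l' := by omega
  exact Or.inr ⟨l, hl, h1, ⟨θ, hθ, hθβ⟩, θ', hθ', hθβ'⟩

/-- Two generators below `τ` whose least upper bound has degree at most `p`. -/
def Linked (S : Set (Fin m → ℕ)) (p : ℕ) (τ β β' : Fin m → ℕ) : Prop :=
  β ∈ S ∧ β' ∈ S ∧ β ≤ τ ∧ β' ≤ τ ∧ deg (β ⊔ β') ≤ p

/-- Induction on `deg τ`. Two generators below the same `τ - 𝐤` are joined by induction. Those below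
`τ - 𝐢` and `τ - 𝐣` are joined through a generator below `τ - 𝐢 - 𝐣`, or through generators below `τ
- 𝐢 - 𝐤` and `τ - 𝐣 - 𝐤`. -/
theorem reflTransGen_linked {S : Set (Fin m → ℕ)} {p : ℕ} (hS : DirConnected p (up S)) :
    ∀ (N : ℕ) (τ : Fin m → ℕ), deg τ = N → ∀ β ∈ S, ∀ β' ∈ S, β ≤ τ → β' ≤ τ →
      (∀ u ∈ S, deg u ≤ p) → Relation.ReflTransGen (Linked S p τ) β β' := by
  intro N
  induction N with
  | zero =>
    intro τ hτ β hβ β' hβ' hle hle' _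
    exact .single ⟨hβ, hβ', hle, hle', (deg_mono (sup_le hle hle')).trans (by omega)⟩
  | succ N ih =>
    intro τ hτ β hβ β' hβ' hle hle' hp
    rcases Nat.lt_or_ge p (N + 1) with hlt | hge
    swap
    · exact .single ⟨hβ, hβ', hle, hle', (deg_mono (sup_le hle hle')).trans (by omega)⟩
    have lift : ∀ (θ : Fin m → ℕ) (k : Fin m), θ + unit k = τ → ∀ u ∈ S, ∀ v ∈ S, u ≤ θ → v ≤ θ →
        Relation.ReflTransGen (Linked S p τ) u v := by
      rintro θ k rfl u hu v hv hle hle'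
      rw [deg_add_unit] at hτ
      refine Relation.ReflTransGen.mono (r := Linked S p θ) ?_ _ _
        (ih θ (by omega) u hu v hv hle hle' hp)
      rintro x y ⟨h1, h2, h3, h4, h5⟩
      exact ⟨h1, h2, h3.trans (le_add_unit θ k), h4.trans (le_add_unit θ k), h5⟩
    obtain ⟨i, x, hx, hβx⟩ := exists_pred hle (by have := hp β hβ; omega)
    obtain ⟨j, y, hy, hβy⟩ := exists_pred hle' (by have := hp β' hβ'; omega)
    by_cases hij : i = j
    · subst hij
      obtain rfl : x = y := add_right_cancel (hx.trans hy.symm)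
      exact lift x i hx β hβ β' hβ' hβx hβy
    have hdx : p ≤ deg x := by
      have := deg_add_unit x i
      rw [hx] at this
      omega
    rcases hS x ⟨β, hβ, hβx⟩ y ⟨β', hβ', hβy⟩ i j hij (hx.trans hy.symm) hdx with
      ⟨θ, ⟨u, hu, huθ⟩, rfl, rfl⟩ | ⟨k, -, -, ⟨θ, ⟨u, hu, huθ⟩, rfl⟩, θ', ⟨v, hv, hvθ⟩, rfl⟩
    · exact (lift _ i hx β hβ u hu hβx (huθ.trans (le_add_unit θ j))).trans
        (lift _ j hy u hu β' hβ' (huθ.trans (le_add_unit θ i)) hβy)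
    · have h1 : θ + unit i + unit k = τ := by rw [← hx, add_right_comm]
      have h2 : θ' + unit j + unit k = τ := by rw [← hy, add_right_comm]
      have h3 : θ + unit i = θ' + unit j := add_right_cancel (h1.trans h2.symm)
      refine ((lift _ i hx β hβ u hu hβx (huθ.trans (le_add_unit θ k))).trans
        (lift _ k h1 u hu v hv (huθ.trans (le_add_unit θ i)) ?_)).trans
        (lift _ j hy v hv β' hβ' (hvθ.trans (le_add_unit θ' k)) hβy)
      rw [h3]
      exact hvθ.trans (le_add_unit θ' j)

/-- Each generator on the path has degree at most `p < deg τ`, so some direction can be attached to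
it. Repeating the first generator allows its direction to change from `i`. -/
theorem chainCondition_of_dirConnected {S : Set (Idx m n)} {p : ℕ} (hp : ∀ α ∈ S, deg α.1 ≤ p)
    (h : ∀ l, DirConnected p (up {β | (β, l) ∈ S})) : ChainCondition p S := by
  rintro τ l - hτ i j - ⟨β, hβ, hβi⟩ ⟨β', hβ', hβj⟩
  replace hτ : p < deg τ := not_le.1 hτ
  have hp' : ∀ u ∈ {β | (β, l) ∈ S}, deg u ≤ p := fun u hu => hp (u, l) hu
  let r : (Fin m → ℕ) × Fin m → (Fin m → ℕ) × Fin m → Prop := fun u v =>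
    ((u.1, l) ∈ S ∧ u.1 + unit u.2 ≤ τ) ∧ deg (u.1 ⊔ v.1) ≤ p
  have hpath : ∀ j : Fin m, ∀ β', Relation.ReflTransGen (Linked {β | (β, l) ∈ S} p τ) β β' →
      β' + unit j ≤ τ → Relation.ReflTransGen r (β, i) (β', j) := by
    intro j β' hpath
    induction hpath generalizing j with
    | refl => exact fun _ => .single ⟨⟨hβ, hβi⟩, by rw [sup_idem]; exact hp' β hβ⟩
    | tail _ hl ih =>
      obtain ⟨h1, -, h3, -, h5⟩ := hl
      intro _
      obtain ⟨k, θ, rfl, hθ⟩ := exists_pred h3 ((hp' _ h1).trans_lt hτ)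
      have hk := add_le_add_left hθ (unit k)
      exact (ih k hk).tail ⟨⟨h1, hk⟩, h5⟩
  have hend := hpath j β' (reflTransGen_linked (h l) _ τ rfl β hβ β' hβ'
    ((le_add_unit β i).trans hβi) ((le_add_unit β' j).trans hβj) hp') hβj
  clear hpath
  have key : ∀ u, Relation.ReflTransGen r u (β', j) →
      ∃ (s : ℕ) (η : Fin (s + 1) → Fin m → ℕ) (κ : Fin (s + 1) → Fin m),
        (∀ q, (η q, l) ∈ S ∧ η q + unit (κ q) ≤ τ) ∧ η 0 = u.1 ∧
        κ 0 = u.2 ∧ κ (Fin.last s) = j ∧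
        ∀ q : Fin s, deg (η q.castSucc ⊔ η q.succ) ≤ p := by
    intro u hu
    induction hu using Relation.ReflTransGen.head_induction_on with
    | refl => exact ⟨0, fun _ => β', fun _ => j, fun _ => ⟨hβ', hβj⟩, rfl, rfl, rfl, fun q => q.elim0⟩
    | @head u v huv _ ih =>
      obtain ⟨s, η, κ, h1, h2, h3, h4, h5⟩ := ih
      refine ⟨s + 1, Fin.cons u.1 η, Fin.cons u.2 κ, ?_, rfl, rfl, ?_, ?_⟩
      · intro q
        refine Fin.cases ?_ (fun q => ?_) q
        · exact huv.1
        · exact h1 q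
      · rw [← Fin.succ_last, Fin.cons_succ]
        exact h4
      · intro q
        refine Fin.cases ?_ (fun q => ?_) q
        · rw [Fin.castSucc_zero, Fin.cons_zero, Fin.cons_succ, h2]
          exact huv.2
        · rw [Fin.castSucc_succ, Fin.cons_succ, Fin.cons_succ]
          exact h5 q
  obtain ⟨s, η, κ, h1, -, h3, h4, h5⟩ := key _ hend
  exact ⟨s, η, κ, h1, h3, h4, h5⟩

theorem C_le {r t : ℕ} (h : ∀ G : Set (Fin m → ℕ), ∃ p, r ≤ p ∧ p ≤ t ∧
    DirConnected p (truncIdeal G p)) : C r m 1 ≤ t := by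
  refine iSup_le fun k => iSup_le fun α => iSup_le fun _ => ?_
  obtain ⟨p, h1, h2, h3⟩ := h {β | (β, 0) ∈ Set.range α}
  refine (iInf₂_le p ⟨h1, chainCondition_of_dirConnected (fun _ h => h.2) fun l => ?_⟩).trans
    (Nat.cast_le.2 h2)
  obtain rfl : l = 0 := Subsingleton.elim _ _
  exact h3

theorem le_C {r t : ℕ} {T : Set (Fin m → ℕ)} (hT : T.Finite) (hanti : IsAntichain (· ≤ ·) T)
    (h : ∀ p, r ≤ p → p < t →
      ¬ ChainCondition p {α : Idx m 1 | α.1 ∈ T ∧ deg α.1 ≤ p}) : (t : ℕ∞) ≤ C r m 1 := by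
  let e := hT.toFinset.equivFin.symm
  let α : Fin hT.toFinset.card → Idx m 1 := fun i => (e i, 0)
  have hα : ∀ i, (α i).1 ∈ T := fun i => hT.mem_toFinset.1 (e i).2
  have hanti' : IsAntichainSeq α := by
    have key : ∀ i j, i ≠ j → ¬ IdxLE (α i) (α j) := by
      intro i j hij hle
      refine hanti (hα i) (hα j) (fun he => hij ?_) hle.2
      exact e.injective (Subtype.ext he)
    exact fun i j hij => ⟨key i j hij, key j i hij.symm⟩
  have hrange : ∀ p, GamSeq α p = {α : Idx m 1 | α.1 ∈ T ∧ deg α.1 ≤ p} := by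
    intro p
    ext x
    refine and_congr_left fun _ => ⟨?_, fun hx => ?_⟩
    · rintro ⟨i, rfl⟩
      exact hα i
    · refine ⟨e.symm ⟨x.1, hT.mem_toFinset.2 hx⟩, ?_⟩
      simp only [α, Equiv.apply_symm_apply]
      exact Prod.ext rfl (Subsingleton.elim _ _)
  refine le_trans ?_ (le_iSup_of_le _ (le_iSup_of_le α (le_iSup_of_le hanti' le_rfl)))
  refine le_iInf₂ fun p hp => Nat.cast_le.2 ?_
  by_contra! hlt
  exact h p hp.1 hlt (hrange p ▸ hp.2)

/-- The chain condition fails if exactly two generators lie below their least upper bound, one of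
which is strictly smaller only in direction `i` and the other one only in direction `j`. -/
theorem not_chainCondition_of_pair {p : ℕ} {T : Set (Fin m → ℕ)} {A B : Fin m → ℕ} {i j : Fin m}
    (hij : i < j) (hA : A ∈ T ∧ deg A ≤ p) (hB : B ∈ T ∧ deg B ≤ p) (hp : p < deg (A ⊔ B))
    (hAi : A i < B i) (hBj : B j < A j) (h : ∀ β ∈ T, β ≤ A ⊔ B → β = A ∨ β = B) :
    ¬ ChainCondition p {α : Idx m 1 | α.1 ∈ T ∧ deg α.1 ≤ p} := by
  intro hc
  have hAB : A ≠ B := by rintro rfl; omega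
  obtain ⟨s, η, κ, h1, h2, h3, h4⟩ := hc (A ⊔ B) 0 ⟨A, B, 0, hAB, hA, hB, rfl⟩ (not_le.2 hp) i j hij
    ⟨A, hA, add_unit_le_of_lt le_sup_left (by rw [Pi.sup_apply]; omega)⟩
    ⟨B, hB, add_unit_le_of_lt le_sup_right (by rw [Pi.sup_apply]; omega)⟩
  have hAB' : ∀ q, η q = A ∨ η q = B := fun q =>
    h _ (h1 q).1.1 ((le_add_unit _ _).trans (h1 q).2)
  have hnot : ∀ (u : Fin m → ℕ) k, u k = (A ⊔ B) k → ¬ u + unit k ≤ A ⊔ B := by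
    intro u k hu hle
    have := apply_le hle k
    rw [add_unit_same] at this
    omega
  -- `B` already attains the maximum in direction `i`, so the chain starts at `A`; it cannot pass to
  -- `B`, because the least upper bound is too large; and `A` attains the maximum in direction `j`,
  -- so the chain cannot end there.
  have hall : ∀ q, η q = A := by
    intro q
    induction q using Fin.induction with
    | zero =>
      refine (hAB' 0).resolve_right fun h0 => hnot B i ?_ ?_
      · rw [Pi.sup_apply]; omega
      · have := (h1 0).2
        rwa [h0, h2] at this
    | succ q ih =>
      refine (hAB' _).resolve_right fun h0 => ?_
      have := h4 q
      rw [ih, h0] at this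
      omega
  refine hnot A j ?_ ?_
  · rw [Pi.sup_apply]; omega
  · have := (h1 (Fin.last s)).2
    rwa [hall, h3] at this

end Chains

/-! ### Extremal antichains and the exact values of `C`. -/

theorem two_mul_le_C (r : ℕ) : ((2 * r : ℕ) : ℕ∞) ≤ C r 2 1 := by
  let T : Set (Fin 2 → ℕ) := {ξ | (ξ 0 = r ∧ ξ 1 = 0) ∨ (ξ 0 < r ∧ ξ 1 + 2 * ξ 0 + 1 = 2 * r)}
  have hT : T.Finite := by
    refine (Set.finite_Iic (fun _ => 2 * r)).subset fun ξ hξ => ?_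
    intro k
    fin_cases k
    · show ξ 0 ≤ 2 * r
      rcases hξ with h | h <;> omega
    · show ξ 1 ≤ 2 * r
      rcases hξ with h | h <;> omega
  refine le_C hT ?_ ?_
  · intro x hx y hy hxy hle
    have h0 := apply_le hle 0
    have h1 := apply_le hle 1
    refine hxy (funext fun k => ?_)
    rcases hx with hx | hx <;> rcases hy with hy | hy <;> fin_cases k <;> simp <;> omega
  · intro p hrp hpt
    -- The stair with first exponent `c` has degree `p`, and its least upper bound with the next
    -- stair has degree `p + 1`. For `c + 1 = r` the truncated subtraction in `B` gives the corner
    -- `(r, 0)`.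
    obtain ⟨c, hc⟩ : ∃ c, p + c + 1 = 2 * r := ⟨2 * r - 1 - p, by omega⟩
    have hA : ![c, 2 * (r - c) - 1] ∈ T ∧ deg ![c, 2 * (r - c) - 1] ≤ p := by
      refine ⟨Or.inr ⟨?_, ?_⟩, ?_⟩ <;> simp [deg] <;> omega
    have hB : ![c + 1, 2 * (r - c) - 3] ∈ T ∧ deg ![c + 1, 2 * (r - c) - 3] ≤ p := by
      refine ⟨?_, ?_⟩
      · rcases eq_or_ne (c + 1) r with h | h
        · refine Or.inl ⟨?_, ?_⟩ <;> simp <;> omega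
        · refine Or.inr ⟨?_, ?_⟩ <;> simp <;> omega
      · simp [deg]; omega
    refine not_chainCondition_of_pair (i := 0) (j := 1) (by decide) hA hB ?_ ?_ ?_ ?_
    · simp [deg]; omega
    · simp
    · simp; omega
    · intro β hβ hle
      have h0 := apply_le hle 0
      have h1 := apply_le hle 1
      simp at h0 h1
      rcases eq_or_ne (β 0) c with h | h
      · left
        funext k
        rcases hβ with hβ | hβ <;> fin_cases k <;> simp <;> omega
      · right
        funext k
        rcases hβ with hβ | hβ <;> fin_cases k <;> simp <;> omega

theorem C_two (r : ℕ) : C r 2 1 = ((2 * r : ℕ) : ℕ∞) := by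
  refine le_antisymm (C_le fun G => ?_) (two_mul_le_C r)
  obtain ⟨p, h1, h2, h3⟩ := exists_noIsolated_two G r
  exact ⟨p, h1, h2, h3.dirConnected_two⟩

theorem three_mul_le_C (r : ℕ) : ((3 * (2 ^ r - 1) : ℕ) : ℕ∞) ≤ C r 3 1 := by
  -- For each first exponent below `r` there is a block on which the last two exponents form a
  -- staircase of slope two, as in two variables; the weight `3 * 2 ^ (r - ξ 0)` makes consecutive
  -- blocks fit together.
  let T : Set (Fin 3 → ℕ) := {ξ | (ξ 0 = r ∧ ξ 1 = 0 ∧ ξ 2 = 0) ∨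
    (ξ 0 < r ∧ ξ 2 + 2 * ξ 1 + 4 = 3 * 2 ^ (r - ξ 0))}
  have hT : T.Finite := by
    refine (Set.finite_Iic (fun _ => r + 3 * 2 ^ r)).subset fun ξ hξ => ?_
    have h2 : 2 ^ (r - ξ 0) ≤ 2 ^ r := Nat.pow_le_pow_right (by norm_num) (Nat.sub_le _ _)
    intro k
    show ξ k ≤ r + 3 * 2 ^ r
    fin_cases k <;> rcases hξ with h | h <;> simp <;> omega
  have hlt : ∀ {a b : ℕ}, a < b → b ≤ r → 2 * 2 ^ (r - b) ≤ 2 ^ (r - a) := by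
    intro a b hab hb
    rw [← pow_succ']
    exact Nat.pow_le_pow_right (by norm_num) (by omega)
  refine le_C hT ?_ ?_
  · intro x hx y hy hxy hle
    have h0 := apply_le hle 0
    have h1 := apply_le hle 1
    have h2 := apply_le hle 2
    refine hxy (funext fun k => ?_)
    rcases hx with hx | hx
    · rcases hy with hy | hy
      · fin_cases k <;> simp <;> omega
      · omega
    · rcases hy with hy | hy
      · have := Nat.one_le_two_pow (n := r - x 0 - 1)
        have h3 : 2 ^ (r - x 0) = 2 * 2 ^ (r - x 0 - 1) := by
          rw [← pow_succ']; congr 1; omega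
        omega
      · rcases Nat.lt_or_ge (x 0) (y 0) with h | h
        · have := hlt h hy.1.le
          have := Nat.one_le_two_pow (n := r - y 0)
          omega
        · have h3 : x 0 = y 0 := le_antisymm h0 h
          rw [h3] at hx
          fin_cases k <;> simp <;> omega
  · intro p hrp hpt
    have hr : r ≠ 0 := by rintro rfl; simp at hpt
    -- The block with first exponent `c = r - k - 1` has elements in the degrees from `c + 3 * 2 ^ k
    -- - 2` to `c + 6 * 2 ^ k - 4`. These intervals tile `[r, 3 (2 ^ r - 1))`, and the least `k`
    -- selects the one containing `p`.
    have hex : ∃ k, p + 4 + (k + 1) ≤ r + 3 * 2 ^ (k + 1) := by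
      refine ⟨r - 1, ?_⟩
      rw [show r - 1 + 1 = r by omega]
      omega
    obtain ⟨k, hkr, hk, hmin⟩ : ∃ k, k + 1 ≤ r ∧ p + 4 + (k + 1) ≤ r + 3 * 2 ^ (k + 1) ∧
        r + 3 * 2 ^ k ≤ p + 3 + k := by
      classical
      refine ⟨Nat.find hex, ?_, Nat.find_spec hex, ?_⟩
      · have : Nat.find hex ≤ r - 1 := by
          refine Nat.find_min' hex ?_
          rw [show r - 1 + 1 = r by omega]
          omega
        omega
      · rcases h : Nat.find hex with _ | k
        · simp; omega
        · have := Nat.find_min hex (m := k) (by omega)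
          omega
    obtain ⟨c, rfl⟩ := Nat.exists_eq_add_of_le' hkr
    obtain ⟨E, hE⟩ : ∃ E, E = 2 ^ k := ⟨_, rfl⟩
    have hE1 : 1 ≤ E := hE ▸ Nat.one_le_two_pow
    rw [pow_succ, ← hE] at hk
    rw [← hE] at hmin
    obtain ⟨y, hy⟩ : ∃ y, p + y + 4 = c + 6 * E := ⟨c + 6 * E - 4 - p, by omega⟩
    have hpc : 2 ^ (c + (k + 1) - c) = 2 * E := by
      rw [hE, ← pow_succ']; congr 1; omega
    have hpc' : 2 ^ (c + (k + 1) - (c + 1)) = E := by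
      rw [hE]; congr 1; omega
    -- the generators below a multiple of the block with first exponent `c`
    have hge : ∀ β ∈ T, 2 * β 1 + β 2 + 4 < 12 * E → c ≤ β 0 := by
      intro β hβ hs
      by_contra! hβc
      have := hlt hβc (by omega)
      rcases hβ with hβ | hβ <;> omega
    rcases Nat.lt_or_ge y (3 * E - 2) with hlt' | hge'
    -- Inside the block, the element of degree `p` is paired with its neighbour of degree `p - 1`.
    · obtain ⟨z, hz⟩ : ∃ z, 2 * y + (z + 2) + 4 = 6 * E := ⟨6 * E - 6 - 2 * y, by omega⟩
      refine not_chainCondition_of_pair (A := ![c, y, z + 2]) (B := ![c, y + 1, z])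
        (i := 1) (j := 2) (by decide) ⟨Or.inr ⟨?_, ?_⟩, ?_⟩ ⟨Or.inr ⟨?_, ?_⟩, ?_⟩ ?_ ?_ ?_ ?_
      · simp
      · change z + 2 + 2 * y + 4 = 3 * 2 ^ (c + (k + 1) - c)
        omega
      · simp [deg, Fin.sum_univ_three]; omega
      · simp
      · change z + 2 * (y + 1) + 4 = 3 * 2 ^ (c + (k + 1) - c)
        omega
      · simp [deg, Fin.sum_univ_three]; omega
      · simp [deg, Fin.sum_univ_three]; omega
      · simp
      · simp
      · intro β hβ hle
        have h0 := apply_le hle 0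
        have h1 := apply_le hle 1
        have h2 := apply_le hle 2
        simp at h0 h1 h2
        have h3 := hge β hβ (by omega)
        have h4 : β 0 = c := le_antisymm h0 h3
        rcases hβ with hβ | hβ
        · omega
        rw [h4, hpc] at hβ
        rcases Nat.lt_or_ge y (β 1) with h5 | h5
        · right
          funext l
          fin_cases l <;> simp <;> omega
        · left
          funext l
          fin_cases l <;> simp <;> omega
    -- At the end `(c, y, 0)` of the block the partner is the end `(c + 1, w, 0)` of the next block,
    -- which is `(r, 0, 0)` if `k = 0`.
    · obtain ⟨w, hw⟩ : ∃ w, (k = 0 ∧ w = 0) ∨ (k ≠ 0 ∧ 2 * w + 4 = 3 * E) := by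
        rcases k with _ | k
        · exact ⟨0, Or.inl ⟨rfl, rfl⟩⟩
        · have := Nat.one_le_two_pow (n := k)
          rw [pow_succ] at hE
          exact ⟨3 * 2 ^ k - 2, Or.inr ⟨by omega, by omega⟩⟩
      have hE0 : k = 0 → E = 1 := by rintro rfl; simpa using hE
      refine not_chainCondition_of_pair (A := ![c, y, 0]) (B := ![c + 1, w, 0])
        (i := 0) (j := 1) (by decide) ⟨Or.inr ⟨?_, ?_⟩, ?_⟩ ⟨?_, ?_⟩ ?_ ?_ ?_ ?_
      · simp
      · change 0 + 2 * y + 4 = 3 * 2 ^ (c + (k + 1) - c)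
        omega
      · simp [deg, Fin.sum_univ_three]; omega
      · rcases hw with hw | hw
        · refine Or.inl ⟨?_, ?_, ?_⟩ <;> simp <;> omega
        · refine Or.inr ⟨?_, ?_⟩
          · simp; omega
          · change 0 + 2 * w + 4 = 3 * 2 ^ (c + (k + 1) - (c + 1))
            omega
      · simp [deg, Fin.sum_univ_three]; omega
      · simp [deg, Fin.sum_univ_three]; omega
      · simp
      · simp; omega
      · intro β hβ hle
        have h0 := apply_le hle 0
        have h1 := apply_le hle 1
        have h2 := apply_le hle 2
        simp at h0 h1 h2
        have h3 := hge β hβ (by omega)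
        rcases eq_or_ne (β 0) c with h4 | h4
        · left
          simp only [T, Set.mem_ofPred_eq, h4, hpc] at hβ
          funext l
          rcases hβ with hβ | hβ <;> fin_cases l <;> simp <;> omega
        · right
          have h5 : β 0 = c + 1 := by omega
          simp only [T, Set.mem_ofPred_eq, h5, hpc'] at hβ
          funext l
          rcases hβ with hβ | hβ <;> fin_cases l <;> simp <;> omega

theorem C_three (r : ℕ) : C r 3 1 = ((3 * (2 ^ r - 1) : ℕ) : ℕ∞) := by
  refine le_antisymm (C_le fun G => ?_) (three_mul_le_C r)
  obtain ⟨p, h1, h2, h3⟩ := exists_noIsolated_three G r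
  exact ⟨p, h1, h2, h3.dirConnected_three⟩

/-! ### Orderly rankings. -/

section Ranking

variable {m : ℕ}

/-- An orderly ranking of `ℕ^m`, given by positions in the order type `ω`. -/
structure IsRanking (ρ : (Fin m → ℕ) → ℕ) : Prop where
  injective : Function.Injective ρ
  add_unit_lt : ∀ ξ τ k, ρ ξ < ρ τ → ρ (ξ + unit k) < ρ (τ + unit k)
  lt_of_deg_lt : ∀ ξ τ, deg ξ < deg τ → ρ ξ < ρ τ

/-- Compare by degree, then lexicographically. Every tuple has finitely many predecessors, and their
number is its position. -/
theorem exists_isRanking (m : ℕ) : ∃ ρ : (Fin m → ℕ) → ℕ, IsRanking ρ := by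
  let lt : (Fin m → ℕ) → (Fin m → ℕ) → Prop := fun η ξ =>
    deg η < deg ξ ∨ (deg η = deg ξ ∧ toLex η < toLex ξ)
  have htrans : ∀ {x y z}, lt x y → lt y z → lt x z := by
    rintro x y z (h | ⟨h, h'⟩) (g | ⟨g, g'⟩)
    · exact Or.inl (h.trans g)
    · exact Or.inl (g ▸ h)
    · exact Or.inl (h ▸ g)
    · exact Or.inr ⟨h.trans g, h'.trans g'⟩
  have hirr : ∀ x, ¬ lt x x := by
    rintro x (h | ⟨-, h⟩)
    · exact lt_irrefl _ h
    · exact lt_irrefl _ h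
  have hfin : ∀ ξ, {η | lt η ξ}.Finite := by
    intro ξ
    refine (Set.finite_Iic (fun _ => deg ξ)).subset fun η hη k => ?_
    have h1 : η k ≤ deg η := Finset.single_le_sum (fun _ _ => Nat.zero_le _) (Finset.mem_univ k)
    have h2 : deg η ≤ deg ξ := by rcases hη with h | h <;> omega
    exact h1.trans h2
  have hmono : ∀ {x y}, lt x y → {η | lt η x}.ncard < {η | lt η y}.ncard := by
    intro x y h
    refine Set.ncard_lt_ncard ⟨fun z hz => htrans hz h, fun hs => hirr x (hs h)⟩ (hfin y)
  have htri : ∀ x y, x ≠ y → lt x y ∨ lt y x := by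
    intro x y hxy
    rcases lt_trichotomy (deg x) (deg y) with h | h | h
    · exact Or.inl (Or.inl h)
    · rcases lt_trichotomy (toLex x) (toLex y) with h' | h' | h'
      · exact Or.inl (Or.inr ⟨h, h'⟩)
      · exact absurd (toLex.injective h') hxy
      · exact Or.inr (Or.inr ⟨h.symm, h'⟩)
    · exact Or.inr (Or.inl h)
  have hiff : ∀ {x y}, {η | lt η x}.ncard < {η | lt η y}.ncard → lt x y := by
    intro x y h
    rcases eq_or_ne x y with rfl | hne
    · exact absurd h (lt_irrefl _)
    · exact (htri x y hne).resolve_right fun h' => absurd (hmono h') (by omega)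
  refine ⟨fun ξ => {η | lt η ξ}.ncard, ⟨fun x y h => ?_, fun x y k h => ?_,
    fun x y h => hmono (Or.inl h)⟩⟩
  · by_contra hne
    have h' : {η | lt η x}.ncard = {η | lt η y}.ncard := h
    rcases htri x y hne with h1 | h1
    · have := hmono h1; omega
    · have := hmono h1; omega
  · refine hmono ?_
    rcases hiff h with h | ⟨h, h'⟩
    · left
      rw [deg_add_unit, deg_add_unit]
      omega
    · right
      refine ⟨by rw [deg_add_unit, deg_add_unit, h], ?_⟩
      rw [toLex_add, toLex_add]
      exact add_lt_add_left h' _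

variable {ρ : (Fin m → ℕ) → ℕ}

theorem IsRanking.lt_add_unit (hρ : IsRanking ρ) (ξ : Fin m → ℕ) (k : Fin m) : ρ ξ < ρ (ξ + unit k) :=
  hρ.lt_of_deg_lt _ _ (by rw [deg_add_unit]; omega)

theorem IsRanking.lt_of_add_unit_lt (hρ : IsRanking ρ) {ξ τ : Fin m → ℕ} {k : Fin m}
    (h : ρ (ξ + unit k) < ρ (τ + unit k)) : ρ ξ < ρ τ := by
  rcases lt_trichotomy (ρ ξ) (ρ τ) with h' | h' | h'
  · exact h'
  · rw [hρ.injective h'] at h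
    omega
  · have := hρ.add_unit_lt _ _ k h'
    omega

theorem IsRanking.deg_le (hρ : IsRanking ρ) {ξ τ : Fin m → ℕ} (h : ρ ξ ≤ ρ τ) : deg ξ ≤ deg τ := by
  by_contra! hlt
  have := hρ.lt_of_deg_lt _ _ hlt
  omega

theorem IsRanking.finite_lt (hρ : IsRanking ρ) (N : ℕ) : {ξ | ρ ξ < N}.Finite :=
  (Set.finite_Iio N).preimage hρ.injective.injOn

theorem IsRanking.exists_lt_iff_deg_le (hρ : IsRanking ρ) (p : ℕ) : ∃ N, ∀ ξ, ρ ξ < N ↔ deg ξ ≤ p := by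
  have hfin : {ξ : Fin m → ℕ | deg ξ ≤ p}.Finite := by
    refine (Set.finite_Iic (fun _ => p)).subset fun η hη k => ?_
    have h1 : η k ≤ deg η := Finset.single_le_sum (fun _ _ => Nat.zero_le _) (Finset.mem_univ k)
    exact h1.trans hη
  refine ⟨hfin.toFinset.sup fun ξ => ρ ξ + 1, fun ξ => ⟨fun h => ?_, fun h => ?_⟩⟩
  · rw [Finset.lt_sup_iff] at h
    obtain ⟨τ, hτ, hlt⟩ := h
    exact (hρ.deg_le (by omega)).trans (hfin.mem_toFinset.1 hτ)
  · exact Finset.le_sup (f := fun ξ => ρ ξ + 1) (hfin.mem_toFinset.2 h)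

end Ranking

/-! ### Extending a partial realization by one rank. -/

section Realization

variable {m : ℕ} {K M : Type u} [Field K] [Field M] [Algebra K M]
  {δ : Fin m → Derivation ℤ K K} {ρ : (Fin m → ℕ) → ℕ} {I : Set (Fin m → ℕ)}

/-- The field generated by the `a ξ` of rank less than that of `τ`. -/
def lowerField (K : Type u) {M : Type u} [Field K] [Field M] [Algebra K M] (ρ : (Fin m → ℕ) → ℕ)
    (a : (Fin m → ℕ) → M) (τ : Fin m → ℕ) : IntermediateField K M :=
  IntermediateField.adjoin K (a '' {ξ | ρ ξ < ρ τ})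

theorem lowerField_mono {a : (Fin m → ℕ) → M} {ξ τ : Fin m → ℕ} (h : ρ ξ ≤ ρ τ) :
    lowerField K ρ a ξ ≤ lowerField K ρ a τ :=
  IntermediateField.adjoin.mono _ _ _ (Set.image_mono fun _ hη => lt_of_lt_of_le hη h)

theorem mem_lowerField {a : (Fin m → ℕ) → M} {ξ τ : Fin m → ℕ} (h : ρ ξ < ρ τ) :
    a ξ ∈ lowerField K ρ a τ :=
  IntermediateField.subset_adjoin _ _ ⟨ξ, h, rfl⟩

theorem lowerField_congr {a a' : (Fin m → ℕ) → M} {τ : Fin m → ℕ}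
    (h : ∀ ξ, ρ ξ < ρ τ → a' ξ = a ξ) : lowerField K ρ a' τ = lowerField K ρ a τ := by
  have himg : a' '' {ξ | ρ ξ < ρ τ} = a '' {ξ | ρ ξ < ρ τ} := Set.image_congr fun ξ hξ => h ξ hξ
  rw [lowerField, lowerField, himg]

/-- A realization up to rank `N`: elements `a ξ` and derivations with `d k (a ξ) = a (ξ + 𝐤)` for
all indices of rank less than `N`, such that `I` is the set of leaders. -/
structure PartialRealization (δ : Fin m → Derivation ℤ K K) (ρ : (Fin m → ℕ) → ℕ)
    (I : Set (Fin m → ℕ)) (N : ℕ) (a : (Fin m → ℕ) → M) (d : Fin m → Derivation ℤ M M) : Prop where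
  extends_base : ∀ k x, d k (algebraMap K M x) = algebraMap K M (δ k x)
  deriv : ∀ ξ k, ρ (ξ + unit k) < N → d k (a ξ) = a (ξ + unit k)
  transcendental : ∀ ξ, ρ ξ < N → ξ ∉ I → Transcendental (lowerField K ρ a ξ) (a ξ)
  isAlgebraic : ∀ ξ, ρ ξ < N → ξ ∈ I → IsAlgebraic (lowerField K ρ a ξ) (a ξ)

variable [CharZero M] {N : ℕ} {a : (Fin m → ℕ) → M} {d : Fin m → Derivation ℤ M M}

/-- The derivative of a leader lies in the field generated by the derivatives of lower rank. -/
theorem derivation_mem_lowerField (hρ : IsRanking ρ) {k : Fin m} {D : Derivation ℤ M M}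
    {ξ : Fin m → ℕ} (hK : ∀ x, D (algebraMap K M x) ∈ lowerField K ρ a (ξ + unit k))
    (hD : ∀ η, ρ η < ρ ξ → D (a η) = a (η + unit k))
    (halg : IsAlgebraic (lowerField K ρ a ξ) (a ξ)) :
    D (a ξ) ∈ lowerField K ρ a (ξ + unit k) := by
  refine derivation_mem_of_isAlgebraic (lowerField_mono (hρ.lt_add_unit ξ k).le) D (fun y hy => ?_)
    (mem_lowerField (hρ.lt_add_unit ξ k)) halg
  refine derivation_mem_of_mem_adjoin D hK ?_ ?_ hy
  · rintro _ ⟨η, hη, rfl⟩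
    exact mem_lowerField (lt_trans hη (hρ.lt_add_unit ξ k))
  · rintro _ ⟨η, hη, rfl⟩
    rw [hD η hη]
    exact mem_lowerField (hρ.add_unit_lt _ _ k hη)

/-- The two mixed derivatives of a leader agree if those of all indices of lower rank do. -/
theorem PartialRealization.deriv_comm (hρ : IsRanking ρ) (hδ : Commuting δ)
    (h : PartialRealization δ ρ I N a d) {θ : Fin m → ℕ} (hθ : θ ∈ I) {i j : Fin m}
    (hN : ρ (θ + unit i + unit j) = N) : d j (a (θ + unit i)) = d i (a (θ + unit j)) := by
  have hi : ρ (θ + unit i) < N := hN ▸ hρ.lt_add_unit _ j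
  have hN' : ρ (θ + unit j + unit i) = N := by rw [add_right_comm, hN]
  have hj : ρ (θ + unit j) < N := hN' ▸ hρ.lt_add_unit _ i
  have hθN : ρ θ < N := (hρ.lt_add_unit θ i).trans hi
  -- The commutator is a derivation that vanishes on the field generated by the lower elements,
  -- hence on `a θ`, which is algebraic over it.
  have h0 : ⁅d j, d i⁆ (a θ) = 0 := by
    refine derivation_eq_zero_of_isAlgebraic (F := lowerField K ρ a θ) _ (fun y hy => ?_)
      (h.isAlgebraic θ hθN hθ)
    refine derivation_eqOn_adjoin (K := K) ⁅d j, d i⁆ 0 (fun x => ?_) ?_ hy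
    · rw [Derivation.commutator_apply, h.extends_base, h.extends_base, h.extends_base,
        h.extends_base, hδ, sub_self, Derivation.zero_apply]
    · rintro _ ⟨η, hη, rfl⟩
      have h1 := hρ.add_unit_lt _ _ i hη
      have h2 := hρ.add_unit_lt _ _ j hη
      have h3 := hρ.add_unit_lt _ _ j h1
      have h4 := hρ.add_unit_lt _ _ i h2
      rw [Derivation.commutator_apply, h.deriv η i (by omega), h.deriv η j (by omega),
        h.deriv _ j (by omega), h.deriv _ i (by omega), add_right_comm, sub_self,
        Derivation.zero_apply]
  rwa [Derivation.commutator_apply, h.deriv θ i hi, h.deriv θ j hj, sub_eq_zero] at h0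

theorem PartialRealization.deriv_eq (hρ : IsRanking ρ) (hδ : Commuting δ)
    (h : PartialRealization δ ρ I N a d) {p : ℕ} (hI : DirConnected p I) {ξ ξ' : Fin m → ℕ}
    (hξ : ξ ∈ I) (hξ' : ξ' ∈ I) {i j : Fin m} (he : ξ + unit i = ξ' + unit j)
    (hN : ρ (ξ + unit i) = N) (hp : p ≤ deg ξ) : d i (a ξ) = d j (a ξ') := by
  rcases eq_or_ne i j with rfl | hij
  · rw [add_right_cancel he]
  rcases hI ξ hξ ξ' hξ' i j hij he hp with ⟨θ, hθ, rfl, rfl⟩ |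
    ⟨k, -, -, ⟨θ, hθ, rfl⟩, θ', hθ', rfl⟩
  · exact h.deriv_comm hρ hδ hθ hN
  · have h1 : θ + unit i = θ' + unit j := by
      refine add_right_cancel (b := unit k) ?_
      rw [add_right_comm θ, he, add_right_comm]
    rw [h.deriv_comm hρ hδ hθ hN, h1,
      h.deriv_comm hρ hδ hθ' (by rw [← h1, add_right_comm, hN])]

/-- If `σ - 𝐤` is not a leader, `a (σ - 𝐤)` is transcendental over the elements of lower rank, so
its derivative can be corrected to `c` by a derivation that kills them; no relation already achieved
is disturbed. -/
theorem PartialRealization.exists_derivation (hρ : IsRanking ρ)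
    (h : PartialRealization δ ρ I N a d) {σ : Fin m → ℕ} (hσ : ρ σ = N) {c : M}
    (hc : ∀ k, ∀ ξ ∈ I, ξ + unit k = σ → d k (a ξ) = c) (k : Fin m) :
    ∃ D : Derivation ℤ M M, (∀ x, D (algebraMap K M x) = algebraMap K M (δ k x)) ∧
      (∀ ξ, ρ (ξ + unit k) < N → D (a ξ) = a (ξ + unit k)) ∧
      ∀ ξ, ξ + unit k = σ → D (a ξ) = c := by
  by_cases hex : ∃ ξ, ξ ∉ I ∧ ξ + unit k = σ
  · obtain ⟨ξ, hξ, rfl⟩ := hex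
    have hξN : ρ ξ < N := hσ ▸ hρ.lt_add_unit ξ k
    obtain ⟨D, hD, hDξ⟩ := exists_derivation_of_transcendental _ (h.transcendental ξ hξN hξ)
      (c - d k (a ξ))
    refine ⟨d k + D, fun x => ?_, fun η hη => ?_, fun η hη => ?_⟩
    · rw [Derivation.add_apply, h.extends_base,
        hD _ ((lowerField K ρ a ξ).algebraMap_mem x), add_zero]
    · rw [Derivation.add_apply, h.deriv η k hη,
        hD _ (mem_lowerField (hρ.lt_of_add_unit_lt (hσ ▸ hη))), add_zero]
    · rw [add_right_cancel hη, Derivation.add_apply, hDξ]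
      ring
  · push Not at hex
    exact ⟨d k, h.extends_base k, fun ξ => h.deriv ξ k,
      fun ξ hξ => hc k ξ (by by_contra hI; exact hex ξ hI hξ) hξ⟩

/-- A partial realization can be extended by one rank. -/
theorem PartialRealization.exists_succ (hρ : IsRanking ρ) (hδ : Commuting δ)
    (hfresh : ∀ S : Set M, S.Finite → ∃ x : M, Transcendental (IntermediateField.adjoin K S) x)
    (hup : ∀ ξ ∈ I, ∀ k, ξ + unit k ∈ I) {p : ℕ} (hI : DirConnected p I)
    (hgen : ∀ ξ ∈ I, p < deg ξ → ∃ k, ∃ θ ∈ I, θ + unit k = ξ)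
    (hN : ∀ ξ, deg ξ ≤ p → ρ ξ < N) (h : PartialRealization δ ρ I N a d) :
    ∃ a' d', PartialRealization δ ρ I (N + 1) a' d' ∧ ∀ ξ, ρ ξ < N → a' ξ = a ξ := by
  by_cases hex : ∃ σ, ρ σ = N
  swap
  · have hlt : ∀ ξ, ρ ξ < N + 1 → ρ ξ < N := fun ξ hξ => by
      rcases Nat.lt_succ_iff_lt_or_eq.1 hξ with h' | h'
      · exact h'
      · exact absurd ⟨ξ, h'⟩ hex
    exact ⟨a, d, ⟨h.extends_base, fun ξ k hξ => h.deriv ξ k (hlt _ hξ),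
      fun ξ hξ => h.transcendental ξ (hlt ξ hξ), fun ξ hξ => h.isAlgebraic ξ (hlt ξ hξ)⟩,
      fun _ _ => rfl⟩
  obtain ⟨σ, hσ⟩ := hex
  have hσp : p < deg σ := by
    by_contra! hle
    have := hN σ hle
    omega
  -- The new element `c` is forced if `σ` is a leader, and `deriv_eq` makes the forced values agree;
  -- otherwise it is a new transcendental and nothing is prescribed, since no leader lies below `σ`.
  obtain ⟨c, hc, hct, hca⟩ : ∃ c : M, (∀ k, ∀ ξ ∈ I, ξ + unit k = σ → d k (a ξ) = c) ∧
      (σ ∉ I → Transcendental (lowerField K ρ a σ) c) ∧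
      (σ ∈ I → IsAlgebraic (lowerField K ρ a σ) c) := by
    by_cases hσI : σ ∈ I
    · obtain ⟨k, θ, hθ, rfl⟩ := hgen σ hσI hσp
      have hθN : ρ θ < N := hσ ▸ hρ.lt_add_unit θ k
      refine ⟨d k (a θ), fun j ξ hξ he => ?_, fun h' => absurd hσI h', fun _ => ?_⟩
      · refine h.deriv_eq hρ hδ hI hξ hθ he (he ▸ hσ) ?_
        rw [← he, deg_add_unit] at hσp
        omega
      · have hmem : d k (a θ) ∈ lowerField K ρ a (θ + unit k) := by
          refine derivation_mem_lowerField hρ (fun x => ?_) (fun η hη => ?_)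
            (h.isAlgebraic θ hθN hθ)
          · rw [h.extends_base]
            exact IntermediateField.algebraMap_mem _ _
          · exact h.deriv η k (hσ ▸ hρ.add_unit_lt _ _ k hη)
        exact isAlgebraic_algebraMap (⟨d k (a θ), hmem⟩ : lowerField K ρ a (θ + unit k))
    · obtain ⟨c, hc⟩ := hfresh (a '' {ξ | ρ ξ < ρ σ}) ((hρ.finite_lt _).image a)
      exact ⟨c, fun k ξ hξ he => absurd (he ▸ hup ξ hξ k) hσI, fun _ => hc,
        fun h' => absurd h' hσI⟩
  choose D hDK hDlt hDσ using h.exists_derivation hρ hσ hc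
  classical
  have ha' : ∀ ξ, ρ ξ < N → Function.update a σ c ξ = a ξ := by
    intro ξ hξ
    refine Function.update_of_ne ?_ _ _
    rintro rfl
    omega
  have hlow : ∀ ξ, ρ ξ ≤ N → lowerField K ρ (Function.update a σ c) ξ = lowerField K ρ a ξ :=
    fun ξ hξ => lowerField_congr fun η hη => ha' η (hη.trans_le hξ)
  have hcase : ∀ ξ, ρ ξ < N + 1 → ρ ξ < N ∨ ξ = σ := by
    intro ξ hξ
    rcases Nat.lt_succ_iff_lt_or_eq.1 hξ with h' | h'
    · exact Or.inl h'
    · exact Or.inr (hρ.injective (h'.trans hσ.symm))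
  refine ⟨Function.update a σ c, D, ⟨hDK, fun ξ k hξ => ?_, fun ξ hξ hξI => ?_,
    fun ξ hξ hξI => ?_⟩, ha'⟩
  · have hlt := hρ.lt_add_unit ξ k
    rw [ha' ξ (by omega)]
    rcases hcase _ hξ with h' | h'
    · rw [ha' _ h', hDlt k ξ h']
    · rw [h', Function.update_self, hDσ k ξ h']
  · rw [hlow ξ (by omega)]
    rcases hcase _ hξ with h' | rfl
    · rw [ha' _ h']
      exact h.transcendental ξ h' hξI
    · rw [Function.update_self]
      exact hct hξI
  · rw [hlow ξ (by omega)]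
    rcases hcase _ hξ with h' | rfl
    · rw [ha' _ h']
      exact h.isAlgebraic ξ h' hξI
    · rw [Function.update_self]
      exact hca hξI

end Realization
-- Passage to all ranks.
section Limit

variable {m : ℕ} {K M : Type u} [Field K] [Field M] [Algebra K M] [CharZero M]
  {δ : Fin m → Derivation ℤ K K} {ρ : (Fin m → ℕ) → ℕ} {I : Set (Fin m → ℕ)}
  {N₀ : ℕ} {a : (Fin m → ℕ) → M} {d : Fin m → Derivation ℤ M M}

/-- A partial realization can be extended to all indices at once. -/
theorem PartialRealization.exists_limit (hρ : IsRanking ρ) (hδ : Commuting δ)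
    (hfresh : ∀ S : Set M, S.Finite → ∃ x : M, Transcendental (IntermediateField.adjoin K S) x)
    (hup : ∀ ξ ∈ I, ∀ k, ξ + unit k ∈ I) {p : ℕ} (hI : DirConnected p I)
    (hgen : ∀ ξ ∈ I, p < deg ξ → ∃ k, ∃ θ ∈ I, θ + unit k = ξ)
    (hN : ∀ ξ, deg ξ ≤ p → ρ ξ < N₀) (h : PartialRealization δ ρ I N₀ a d) :
    ∃ A : (Fin m → ℕ) → M, (∀ ξ, ρ ξ < N₀ → A ξ = a ξ) ∧
      ∀ N, ∃ d' : Fin m → Derivation ℤ M M,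
        (∀ k x, d' k (algebraMap K M x) = algebraMap K M (δ k x)) ∧
        ∀ ξ k, ρ (ξ + unit k) < N → d' k (A ξ) = A (ξ + unit k) := by
  have hstep : ∀ n (s : {ad : ((Fin m → ℕ) → M) × (Fin m → Derivation ℤ M M) //
      PartialRealization δ ρ I (N₀ + n) ad.1 ad.2}),
      ∃ s' : {ad : ((Fin m → ℕ) → M) × (Fin m → Derivation ℤ M M) //
        PartialRealization δ ρ I (N₀ + (n + 1)) ad.1 ad.2},
        ∀ ξ, ρ ξ < N₀ + n → s'.1.1 ξ = s.1.1 ξ := by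
    rintro n ⟨⟨a, d⟩, h⟩
    obtain ⟨a', d', h', heq⟩ := h.exists_succ hρ hδ hfresh hup hI hgen
      (fun ξ hξ => (hN ξ hξ).trans_le (Nat.le_add_right _ _))
    exact ⟨⟨(a', d'), h'⟩, heq⟩
  choose f hf using hstep
  let s : ∀ n, {ad : ((Fin m → ℕ) → M) × (Fin m → Derivation ℤ M M) //
      PartialRealization δ ρ I (N₀ + n) ad.1 ad.2} := fun n => Nat.rec ⟨(a, d), h⟩ f n
  have hs : ∀ n k ξ, ρ ξ < N₀ + n → (s (n + k)).1.1 ξ = (s n).1.1 ξ := by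
    intro n k ξ hξ
    induction k with
    | zero => rfl
    | succ k ih => exact (hf (n + k) (s (n + k)) ξ (by omega)).trans ih
  have hA : ∀ n ξ, ρ ξ < N₀ + n → (s (ρ ξ + 1)).1.1 ξ = (s n).1.1 ξ := by
    intro n ξ hξ
    rcases le_total n (ρ ξ + 1) with h' | h'
    · obtain ⟨k, hk⟩ := Nat.exists_eq_add_of_le h'
      rw [hk]
      exact hs n k ξ hξ
    · obtain ⟨k, rfl⟩ := Nat.exists_eq_add_of_le h'
      exact (hs (ρ ξ + 1) k ξ (by omega)).symm
  -- The elements stabilize, but the derivations of `M` may change at every stage, so each `N` keeps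
  -- its own.
  refine ⟨fun ξ => (s (ρ ξ + 1)).1.1 ξ, fun ξ hξ => hA 0 ξ hξ, fun N => ⟨(s N).1.2,
    (s N).2.extends_base, fun ξ k hξ => ?_⟩⟩
  have hlt := hρ.lt_add_unit ξ k
  dsimp only
  rw [hA N ξ (by omega), hA N (ξ + unit k) (by omega)]
  exact (s N).2.deriv ξ k (by omega)

end Limit

/-! ### Gluing derivations along an increasing union. -/

section DirectedUnion

variable {K M ι : Type*} [Field K] [Field M] [Algebra K M]

theorem exists_mem_adjoin_image_of_monotone (A : ι → M) {S : ℕ → Set ι} (hS : Monotone S)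
    (hex : ∀ i, ∃ N, i ∈ S N) {y : M} (hy : y ∈ IntermediateField.adjoin K (Set.range A)) :
    ∃ N, y ∈ IntermediateField.adjoin K (A '' S N) := by
  have hmono : ∀ {N N'}, N ≤ N' →
      IntermediateField.adjoin K (A '' S N) ≤ IntermediateField.adjoin K (A '' S N') := fun h =>
    IntermediateField.adjoin.mono _ _ _ (Set.image_mono (hS h))
  induction hy using IntermediateField.adjoin_induction with
  | mem x hx =>
    obtain ⟨i, rfl⟩ := hx
    obtain ⟨N, hN⟩ := hex i
    exact ⟨N, IntermediateField.subset_adjoin _ _ ⟨i, hN, rfl⟩⟩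
  | algebraMap x => exact ⟨0, IntermediateField.algebraMap_mem _ x⟩
  | add x y _ _ hx hy =>
    obtain ⟨N, hN⟩ := hx
    obtain ⟨N', hN'⟩ := hy
    exact ⟨max N N', add_mem (hmono (le_max_left _ _) hN) (hmono (le_max_right _ _) hN')⟩
  | inv x _ hx =>
    obtain ⟨N, hN⟩ := hx
    exact ⟨N, inv_mem hN⟩
  | mul x y _ _ hx hy =>
    obtain ⟨N, hN⟩ := hx
    obtain ⟨N', hN'⟩ := hy
    exact ⟨max N N', mul_mem (hmono (le_max_left _ _) hN) (hmono (le_max_right _ _) hN')⟩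

/-- Derivations with prescribed values on the members of an increasing sequence of sets of
generators can be glued to a derivation of the field generated by the union. -/
theorem exists_derivation_adjoin_range (δ : Derivation ℤ K K) (A B : ι → M)
    (hB : ∀ i, B i ∈ IntermediateField.adjoin K (Set.range A)) {S : ℕ → Set ι} (hS : Monotone S)
    (hex : ∀ i, ∃ N, i ∈ S N)
    (hd : ∀ N, ∃ d : Derivation ℤ M M, (∀ x, d (algebraMap K M x) = algebraMap K M (δ x)) ∧
      ∀ i ∈ S N, d (A i) = B i) :
    ∃ D : Derivation ℤ (IntermediateField.adjoin K (Set.range A))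
        (IntermediateField.adjoin K (Set.range A)),
      (∀ x, D (algebraMap K _ x) = algebraMap K _ (δ x)) ∧
      ∀ i (y : IntermediateField.adjoin K (Set.range A)), (y : M) = A i → (D y : M) = B i := by
  choose d hdK hdA using hd
  have hmono : ∀ {N N'}, N ≤ N' →
      IntermediateField.adjoin K (A '' S N) ≤ IntermediateField.adjoin K (A '' S N') := fun h =>
    IntermediateField.adjoin.mono _ _ _ (Set.image_mono (hS h))
  have hle : ∀ {N N' y}, N ≤ N' → y ∈ IntermediateField.adjoin K (A '' S N) →
      d N y = d N' y := by
    intro N N' y h hy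
    refine derivation_eqOn_adjoin (K := K) (d N) (d N') (fun x => by rw [hdK, hdK]) ?_ hy
    rintro _ ⟨i, hi, rfl⟩
    rw [hdA N i hi, hdA N' i (hS h hi)]
  have hagree : ∀ {N N' y}, y ∈ IntermediateField.adjoin K (A '' S N) →
      y ∈ IntermediateField.adjoin K (A '' S N') → d N y = d N' y := by
    intro N N' y h h'
    rw [hle (le_max_left N N') h, hle (le_max_right N N') h']
  have hmem : ∀ {N y}, y ∈ IntermediateField.adjoin K (A '' S N) →
      d N y ∈ IntermediateField.adjoin K (Set.range A) := by
    intro N y hy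
    refine derivation_mem_of_mem_adjoin (d N) (fun x => ?_) ?_ ?_ hy
    · rw [hdK]
      exact IntermediateField.algebraMap_mem _ _
    · rintro _ ⟨i, -, rfl⟩
      exact IntermediateField.subset_adjoin _ _ ⟨i, rfl⟩
    · rintro _ ⟨i, hi, rfl⟩
      rw [hdA N i hi]
      exact hB i
  -- Any stage whose field contains `y` computes the glued derivation at `y`; `hagree` makes the
  -- choice irrelevant.
  choose n hn using fun y : IntermediateField.adjoin K (Set.range A) =>
    exists_mem_adjoin_image_of_monotone A hS hex y.2
  have hval : ∀ {N} {y : IntermediateField.adjoin K (Set.range A)},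
      (y : M) ∈ IntermediateField.adjoin K (A '' S N) → d (n y) y = d N y :=
    fun {N y} h => hagree (hn y) h
  let D₀ : IntermediateField.adjoin K (Set.range A) →+ IntermediateField.adjoin K (Set.range A) :=
    AddMonoidHom.mk' (fun y => ⟨d (n y) y, hmem (hn y)⟩) fun x y => by
      have hx := hmono (le_max_left (n x) (n y)) (hn x)
      have hy := hmono (le_max_right (n x) (n y)) (hn y)
      refine Subtype.ext ?_
      change d (n (x + y)) (x + y : M) = d (n x) x + d (n y) y
      rw [hval hx, hval hy, ← map_add]
      exact hval (y := x + y) (add_mem hx hy)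
  refine ⟨Derivation.mk' D₀.toIntLinearMap fun x y => ?_, fun x => ?_, fun i y hy => ?_⟩
  · have hx := hmono (le_max_left (n x) (n y)) (hn x)
    have hy := hmono (le_max_right (n x) (n y)) (hn y)
    refine Subtype.ext ?_
    change d (n (x * y)) (x * y : M) = (x : M) * d (n y) y + (y : M) * d (n x) x
    rw [hval hx, hval hy]
    exact (hval (y := x * y) (mul_mem hx hy)).trans (Derivation.leibniz _ _ _)
  · exact Subtype.ext (hdK (n _) x)
  · obtain ⟨N, hN⟩ := hex i
    have h : (y : M) ∈ IntermediateField.adjoin K (A '' S N) :=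
      hy ▸ IntermediateField.subset_adjoin _ _ ⟨i, hN, rfl⟩
    change d (n y) y = B i
    rw [hval h, hy, hdA N i hN]

theorem adjoin_eq_top_of_coe_eq {A : ι → M} (A' : ι → IntermediateField.adjoin K (Set.range A))
    (hA' : ∀ i, (A' i : M) = A i) : IntermediateField.adjoin K (Set.range A') = ⊤ := by
  apply IntermediateField.lift_injective
  rw [IntermediateField.lift_adjoin, IntermediateField.lift_top, ← Set.range_comp]
  exact congrArg _ (congrArg _ (funext hA'))

/-- An embedding of a field maps it isomorphically to the field generated by the images of its
generators. -/
theorem exists_algEquiv_adjoin {L : Type*} [Field L] [Algebra K L] (f : L →ₐ[K] M) {S : Set L}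
    (hS : IntermediateField.adjoin K S = ⊤) {S' : Set M} (hS' : f '' S = S') :
    ∃ φ : L ≃ₐ[K] IntermediateField.adjoin K S', ∀ x, (φ x : M) = f x := by
  have h : f.fieldRange = IntermediateField.adjoin K S' := by
    rw [← hS', ← IntermediateField.adjoin_map, hS, ← AlgHom.fieldRange_eq_map]
  exact ⟨(AlgEquiv.ofInjectiveField f).trans (IntermediateField.equivOfEq h), fun x => rfl⟩

end DirectedUnion

theorem iterDeriv_eq {m : ℕ} {M : Type*} [Field M] {d : Fin m → Derivation ℤ M M}
    {A : (Fin m → ℕ) → M} (hd : ∀ k ξ, d k (A ξ) = A (ξ + unit k)) (ξ : Fin m → ℕ) :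
    iterDeriv d ξ (A 0) = A ξ := by
  have hiter : ∀ k n η, (d k)^[n] (A η) = A (η + n • unit k) := by
    intro k n
    induction n with
    | zero => simp
    | succ n ih =>
      intro η
      rw [Function.iterate_succ_apply, hd, ih, succ_nsmul', add_assoc]
  have hfold : ∀ l : List (Fin m), l.foldr (fun k y => (d k)^[ξ k] y) (A 0) =
      A ((l.map fun k => ξ k • unit k).sum) := by
    intro l
    induction l with
    | nil => rfl
    | cons k l ih => rw [List.foldr_cons, ih, hiter, List.map_cons, List.sum_cons, add_comm]
  rw [iterDeriv, hfold]
  congr 1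
  rw [← List.ofFn_eq_map, List.sum_ofFn]
  ext j
  simp [unit, Finset.sum_apply, Pi.single_apply]

/-! ### Regular realizations and the bound on `T`. -/

section Main

variable {m n s : ℕ} {K L : Type u} [Field K] [Field L] [Algebra K L]
  {δ : Fin m → Derivation ℤ K K}

/-- The derivations of a kernel extend to every field extension. -/
theorem DifferentialKernel.exists_derivation (P : DifferentialKernel δ n s L) (M : Type u)
    [Field M] [CharZero M] [Algebra L M] [Algebra K M] [IsScalarTower K L M] :
    ∃ e : Fin m → Derivation ℤ M M,
      (∀ k x, e k (algebraMap K M x) = algebraMap K M (δ k x)) ∧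
      ∀ k α, deg α.1 < s → e k (algebraMap L M (P.a α)) =
        algebraMap L M (P.a (α.1 + unit k, α.2)) := by
  have : CharZero L := ((algebraMap L M).charZero_iff (algebraMap L M).injective).2 inferInstance
  choose d hd using fun k => exists_derivation_extension (P.D k)
  choose e he using fun k =>
    exists_derivation_extension ((Algebra.linearMap L M).compDer (d k))
  refine ⟨e, fun k x => ?_, fun k α hα => ?_⟩
  · rw [IsScalarTower.algebraMap_apply K L M, he, IsScalarTower.algebraMap_apply K L M (δ k x),
      ← P.D_extends, ← hd]
    rfl
  · rw [he, ← P.D_gen k α hα, ← hd]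
    rfl

/-- If for every `N` there are derivations acting on the members of `A` of rank less than `N` like
shifts of the index, then `A` is the family of derivatives of `A 0` in a differential field. -/
theorem exists_commuting_derivations {M : Type u} [Field M] [Algebra K M] (hδ : Commuting δ)
    {ρ : (Fin m → ℕ) → ℕ} (A : (Fin m → ℕ) → M)
    (hA : ∀ N, ∃ d : Fin m → Derivation ℤ M M,
      (∀ k x, d k (algebraMap K M x) = algebraMap K M (δ k x)) ∧
      ∀ ξ k, ρ (ξ + unit k) < N → d k (A ξ) = A (ξ + unit k)) :
    ∃ (d : Fin m → Derivation ℤ (IntermediateField.adjoin K (Set.range A))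
        (IntermediateField.adjoin K (Set.range A)))
      (g : IntermediateField.adjoin K (Set.range A)), Commuting d ∧
      (∀ k x, d k (algebraMap K _ x) = algebraMap K _ (δ k x)) ∧
      ∀ ξ, ((iterDeriv d ξ g : IntermediateField.adjoin K (Set.range A)) : M) = A ξ := by
  choose e heK heA using hA
  have hmem : ∀ ξ, A ξ ∈ IntermediateField.adjoin K (Set.range A) := fun ξ =>
    IntermediateField.subset_adjoin _ _ ⟨ξ, rfl⟩
  choose d hdK hdA using fun k => exists_derivation_adjoin_range (δ k) A (fun ξ => A (ξ + unit k))
    (fun ξ => hmem _) (S := fun N => {ξ | ρ (ξ + unit k) < N})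
    (fun N N' h ξ (hξ : ρ (ξ + unit k) < N) => (lt_of_lt_of_le hξ h : _ < N'))
    (fun ξ => ⟨ρ (ξ + unit k) + 1, Nat.lt_succ_self _⟩)
    (fun N => ⟨e N k, heK N k, fun ξ hξ => heA N ξ k hξ⟩)
  let A' : (Fin m → ℕ) → IntermediateField.adjoin K (Set.range A) := fun ξ => ⟨A ξ, hmem ξ⟩
  have hd : ∀ k ξ, d k (A' ξ) = A' (ξ + unit k) := fun k ξ => Subtype.ext (hdA k ξ (A' ξ) rfl)
  refine ⟨d, A' 0, fun i j x => ?_, hdK, fun ξ => congrArg Subtype.val (iterDeriv_eq hd ξ)⟩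
  have h0 : ⁅d i, d j⁆ x = (0 : Derivation ℤ _ _) x := by
    refine derivation_eqOn_adjoin (K := K) (S := Set.range A') _ _ (fun x => ?_) ?_ ?_
    · rw [Derivation.commutator_apply, hdK, hdK, hdK, hdK, hδ, sub_self, Derivation.zero_apply]
    · rintro _ ⟨ξ, rfl⟩
      rw [Derivation.commutator_apply, hd, hd, hd, hd, add_right_comm, sub_self,
        Derivation.zero_apply]
    · rw [adjoin_eq_top_of_coe_eq A' fun _ => rfl]
      exact IntermediateField.mem_top
  rwa [Derivation.commutator_apply, Derivation.zero_apply, sub_eq_zero] at h0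

/-- The level `p` is chosen for the set of leaders of the prolongation. Since `r ≤ p`, rebuilding
above degree `p` keeps the generators of the original kernel. -/
theorem prolongationSuffices_of_dirConnected {r t : ℕ} (hG : ∀ G : Set (Fin m → ℕ),
    ∃ p, r ≤ p ∧ p ≤ t ∧ DirConnected p (truncIdeal G p)) :
    ProlongationSuffices.{u} r m 1 t := by
  rintro K _ _ δ hδ L _ _ P ⟨L', _, _, P', hrt, ι, hι, -⟩
  have : CharZero L' := ((algebraMap K L').charZero_iff (algebraMap K L').injective).1 inferInstance
  -- Infinitely many variables supply a new transcendental at every stage without changing the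
  -- field.
  let M := FractionRing (MvPolynomial ℕ L')
  have : CharZero M := ((algebraMap L' M).charZero_iff (algebraMap L' M).injective).1 inferInstance
  obtain ⟨ρ, hρ⟩ := exists_isRanking m
  obtain ⟨e, heK, heP⟩ := P'.exists_derivation M
  let b : (Fin m → ℕ) → M := fun ξ => algebraMap L' M (P'.a (ξ, 0))
  have heb : ∀ k ξ, deg ξ < t → e k (b ξ) = b (ξ + unit k) := fun k ξ h => heP k (ξ, 0) h
  let E : Set (Fin m → ℕ) := {ξ | deg ξ ≤ t ∧ IsAlgebraic (lowerField K ρ b ξ) (b ξ)}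
  have hEsucc : ∀ ξ ∈ E, ∀ k, deg ξ < t → ξ + unit k ∈ E := by
    rintro ξ ⟨-, hξ⟩ k hlt
    refine ⟨by rw [deg_add_unit]; omega, ?_⟩
    have hmem : e k (b ξ) ∈ lowerField K ρ b (ξ + unit k) := by
      refine derivation_mem_lowerField hρ (fun x => ?_) (fun η hη => ?_) hξ
      · rw [heK]
        exact IntermediateField.algebraMap_mem _ _
      · exact heb k η ((hρ.deg_le hη.le).trans_lt hlt)
    rw [heb k ξ hlt] at hmem
    exact isAlgebraic_algebraMap (⟨b (ξ + unit k), hmem⟩ : lowerField K ρ b (ξ + unit k))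
  have hEup : ∀ d β ξ, β ∈ E → β ≤ ξ → deg ξ = deg β + d → deg ξ ≤ t → ξ ∈ E := by
    intro d
    induction d with
    | zero =>
      intro β ξ hβ hle hd _
      exact eq_of_le_of_deg_le hle (by omega) ▸ hβ
    | succ d ih =>
      intro β ξ hβ hle hd hξ
      obtain ⟨k, θ, rfl, hθ⟩ := exists_pred hle (by omega)
      rw [deg_add_unit] at hd hξ
      exact hEsucc θ (ih β θ hβ hθ (by omega) (by omega)) k (by omega)
  obtain ⟨p, hrp, hpt, hI⟩ := hG E
  -- Derivatives of leaders are leaders up to degree `t`, so the generated ideal contains no new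
  -- index of degree at most `p`.
  have hmemI : ∀ ξ, deg ξ ≤ p → (ξ ∈ truncIdeal E p ↔ ξ ∈ E) := by
    refine fun ξ hξ => ⟨?_, fun h => subset_up _ ⟨h, hξ⟩⟩
    rintro ⟨β, ⟨hβ, -⟩, hle⟩
    have hd := deg_mono hle
    exact hEup (deg ξ - deg β) β ξ hβ hle (by omega) (by omega)
  obtain ⟨N₀, hN₀⟩ := hρ.exists_lt_iff_deg_le p
  have hpr : PartialRealization δ ρ (truncIdeal E p) N₀ b e := by
    refine ⟨heK, fun ξ k h => heb k ξ ?_, fun ξ h hξ => ?_, fun ξ h hξ => ?_⟩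
    · rw [hN₀, deg_add_unit] at h
      omega
    · rw [hN₀] at h
      rw [hmemI ξ h] at hξ
      exact fun halg => hξ ⟨h.trans hpt, halg⟩
    · rw [hN₀] at h
      exact ((hmemI ξ h).1 hξ).2
  obtain ⟨A, hAb, hA⟩ := hpr.exists_limit hρ hδ
    (fun S hS => exists_transcendental_adjoin_finite K L' hS)
    (fun ξ hξ k => mem_up_of_le hξ (le_add_unit ξ k)) hI
    (by
      rintro ξ ⟨β, ⟨hβ, hβp⟩, hle⟩ hξ
      obtain ⟨k, θ, hθ, hβθ⟩ := exists_pred hle (hβp.trans_lt hξ)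
      exact ⟨k, θ, ⟨β, ⟨hβ, hβp⟩, hβθ⟩, hθ⟩)
    (fun ξ => (hN₀ ξ).2)
  obtain ⟨d, g, hd, hdK, hg⟩ := exists_commuting_derivations hδ A hA
  let f : L →ₐ[K] M := (IsScalarTower.toAlgHom K L' M).comp ι
  have hf : ∀ α ∈ Gam m 1 r, f (P.a α) = A α.1 := by
    rintro ⟨ξ, i⟩ hα
    have hξ : deg ξ ≤ r := hα
    rw [Subsingleton.elim i 0] at hα ⊢
    rw [hAb ξ ((hN₀ ξ).2 (hξ.trans hrp))]
    exact congrArg (algebraMap L' M) (hι _ hα)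
  have hfle : (⊤ : IntermediateField K L).map f ≤ IntermediateField.adjoin K (Set.range A) := by
    rw [← P.adjoin_eq_top, IntermediateField.adjoin_map, IntermediateField.adjoin_le_iff]
    rintro _ ⟨_, ⟨α, hα, rfl⟩, rfl⟩
    exact IntermediateField.subset_adjoin _ _ ⟨α.1, (hf α hα).symm⟩
  let f' : L →ₐ[K] IntermediateField.adjoin K (Set.range A) :=
    f.codRestrict (IntermediateField.adjoin K (Set.range A)).toSubalgebra
      fun x => hfle ⟨x, IntermediateField.mem_top, rfl⟩
  have hf' : ∀ α ∈ Gam m 1 r, f' (P.a α) = iterDeriv d α.1 g := fun α hα =>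
    Subtype.ext ((hf α hα).trans (hg α.1).symm)
  refine ⟨_, inferInstance, inferInstance, d, fun _ => g, hd, hdK, ?_⟩
  obtain ⟨φ, hφ⟩ := exists_algEquiv_adjoin f' P.adjoin_eq_top
    (S' := (fun α : Idx m 1 => iterDeriv d α.1 g) '' Gam m 1 r)
    (by rw [Set.image_image]; exact Set.image_congr hf')
  exact ⟨φ, fun α hα => (hφ _).trans (hf' α hα)⟩

theorem T_three_le (r : ℕ) : T.{u} r 3 1 ≤ ((3 * (2 ^ r - 1) : ℕ) : ℕ∞) := by
  have hr : r ≤ 3 * (2 ^ r - 1) := by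
    have := Nat.lt_two_pow_self (n := r)
    omega
  refine iInf₂_le _ ⟨hr, prolongationSuffices_of_dirConnected fun G => ?_⟩
  obtain ⟨p, h1, h2, h3⟩ := exists_noIsolated_three G r
  exact ⟨p, h1, h2, h3.dirConnected_three⟩

end Main

end DiffKer

theorem corollary5p5 (r : ℕ) :
    DiffKer.C r 2 1 = ((2 * r : ℕ) : ℕ∞) ∧
    DiffKer.C r 3 1 = ((3 * (2 ^ r - 1) : ℕ) : ℕ∞) ∧
    DiffKer.T.{u} r 3 1 ≤ ((3 * (2 ^ r - 1) : ℕ) : ℕ∞) :=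
  ⟨DiffKer.C_two r, DiffKer.C_three r, DiffKer.T_three_le r⟩
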